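/- **Game.** Let $n\ge 1$ and let $\Theta,S,\mathcal A$ be finite sets. A game consists of a prior $p\in\Delta(\Theta)$, a signaling scheme $\psi:\Theta\to\Delta(S)$ and utilities $u_R,u_S:\mathcal A\times\Theta\to[0,1]$ of the receiver and (in common) of the $n$ senders. Given the state $\theta\sim p$, the $n$ senders' signals are drawn independently from $\psi(\cdot|\theta)$; write $\psi(\mathbf s|\theta)=\prod_{j}\psi(s_j|\theta)$ for $\mathbf s\in S^n$. Let $\Phi$ be a nonempty set of deviation functions $\varphi:S\to S$. A mechanism is a map $x:S^n\to\Delta(\mathcal A)$; put $U_j(x)=\sum_{\mathbf s,a}x[\mathbf s,a]\sum_\theta p(\theta)u_j(a,\theta)\psi(\mathbf s|\theta)$ for $j\in\{R,S\}$ and, for a sender $i$, $U_i^\varphi(x)=\sum_{\mathbf s,a}x[(\varphi(s_i),\mathbf s_{-i}),a]\sum_\theta p(\theta)u_S(a,\theta)\psi(\mathbf s|\theta)$. The mechanism is incentive compatible (IC) if $U_i^\varphi(x)\le U_S(x)$ for all $i$ and all $\varphi\in\Phi$. Let $x^\star$ be an optimal IC mechanism, i.e. a maximizer of $U_R$ over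 the IC mechanisms. Let $\mathcal C$ be the set of classes of signal profiles that contain each signal equally often, $c(\mathbf s)$ the class of $\mathbf s$, and $\Xi=\{\xi\in\mathbb R_{\ge0}^{\mathcal C\times\mathcal A}:\sum_a\xi[c,a]=1\ \forall c\}$ the set of symmetric mechanisms. Let $r_j[c,a]=\sum_{\mathbf s\in c}\sum_\theta p(\theta)u_j(a,\theta)\psi(\mathbf s|\theta)$, and let $A^\varphi[(c,a),(c',a')]$ be $0$ if $a\ne a'$ and $|\{\mathbf s\in c':(\varphi(s_i),\mathbf s_{-i})\in c\}|/|c'|$ if $a=a'$ (this does not depend on the sender $i$). For $\varepsilon\ge0$ and $\rho_R,\rho_S\in\mathbb R^{\mathcal C\times\mathcal A}$ let $\mathrm{LP}(\varepsilon,\rho_R,\rho_S)$ be the problem of maximizing $\xi^\top\rho_R$ over $\xi\in\Xi$ subject to $\xi^\top(A^\varphi\rho_S-\rho_S)\le\varepsilon$ for all $\varphi\in\Phi$. **Interaction and algorithm.** Fix $T\ge1$, $\delta\in(0,1)$ and $E\in\{1,\dots,T\}$, and put $L=\log(8T|\mathcal C||\mathcal A|/\delta)$ and $\nu=2|\mathcal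 C|\sqrt{L/(2E)}$. In each round $t=1,\dots,T$ the receiver, who does not know $p,\psi,u_R,u_S$, selects $\xi^t\in\Xi$ from her past feedback and samples a deterministic mechanism $\pi^t:\mathcal C\to\mathcal A$ from it (independently over $c$, $\pi^t(c)\sim\xi^t[c,\cdot]$). A fresh state $\theta^t\sim p$ and truthfully reported signals $\mathbf s^t\sim\psi(\cdot|\theta^t)$ are drawn, independently of the past and of $\pi^t$, the action $a^t=\pi^t(c(\mathbf s^t))$ is played, and the receiver observes $\mathbf s^t$, $a^t$, $u_R(a^t,\theta^t)$ and $u_S(a^t,\theta^t)$. Let $N^{t-1}[c,a]=|\{\tau<t:\pi^\tau(c)=a\}|$ and, when this is positive, $$\hat r_j^t[c,a]=\frac1{N^{t-1}[c,a]}\sum_{\tau<t,\ \pi^\tau(c)=a}u_j(a^\tau,\theta^\tau)\mathbf 1[\mathbf s^\tau\in c],\qquad \eta^t[c,a]=\sqrt{\frac{L}{2N^{t-1}[c,a]}} .$$ The algorithm with parameters $(T,E,\delta)$ selects $\xi^t$ as follows. If $t\le|\mathcal A|E$, it picks $a\in\arg\min_{a}\sum_cN^{t-1}[c,a]$ and sets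 $\xi^t[c,a']=\mathbf 1[a'=a]$ for all $c,a'$. If $t>|\mathcal A|E$, $\xi^t$ is an optimal solution of $\mathrm{LP}(\nu,\hat r_R^t+\eta^t,\hat r_S^t)$. All ties are broken arbitrarily (as a function of the past feedback). Let $$R^T=\sum_{t=1}^T\bigl[U_R(x^\star)-(\xi^t)^\top r_R\bigr],\qquad V^T=\sum_{t=1}^T\max_{\varphi\in\Phi}(\xi^t)^\top(A^\varphi r_S-r_S).$$ **Theorem.** There is an absolute constant $K>0$ such that the following holds for every such game, every $T\ge 1$ and every $\delta\in(0,1)$. 1. For every $E\in\{1,\dots,T\}$, the algorithm with parameters $(T,E,\delta)$ guarantees, with probability at least $1-\delta$, both $$R^T\le K\Bigl(|\mathcal A|E+|\mathcal C||\mathcal A|\sqrt{T\log(8T|\mathcal C||\mathcal A|/\delta)}\Bigr),\qquad V^T\le K\,T|\mathcal C|\sqrt{\log(8T|\mathcal C||\mathcal A|/\delta)/E}.$$ 2. For every $\alpha\in[1/2,1]$, the algorithm with $E=\lfloor T^\alpha\rfloor$ guarantees, with probability at least $1-\delta$, both $$R^T\le K|\mathcal C||\mathcal A|\sqrt{\log(8T|\mathcal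 C||\mathcal A|/\delta)}\;T^{\alpha},\qquad V^T\le K|\mathcal C|\sqrt{\log(8T|\mathcal C||\mathcal A|/\delta)}\;T^{1-\alpha/2},$$ that is, $R^T=\tilde O(T^\alpha)$ and $V^T=\tilde O(T^{1-\alpha/2})$. -/

import Mathlib

noncomputable section

open scoped Matrix

namespace InfoAcq

/-! ## Signal profiles and symmetric classes -/

open Classical in
/-- Two signal profiles are symmetric when every signal occurs equally often in both. -/
def symmetricProfiles (n : ℕ) (S : Type*) : Setoid (Fin n → S) where
  r s s' := ∀ x : S, (∑ i, if s i = x then 1 else 0 : ℕ) = ∑ i, if s' i = x then 1 else 0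
  iseqv := ⟨fun _ _ => rfl, fun h x => (h x).symm, fun h h' x => (h x).trans (h' x)⟩

/-- The set `𝒞` of classes of symmetric signal profiles. -/
def Class (n : ℕ) (S : Type*) : Type _ := Quotient (symmetricProfiles n S)

/-- The class `c(s)` of a signal profile `s`. -/
def classOf {n : ℕ} {S : Type*} (s : Fin n → S) : Class n S :=
  Quotient.mk (symmetricProfiles n S) s

instance instFiniteClass (n : ℕ) (S : Type*) [Finite S] : Finite (Class n S) :=
  inferInstanceAs (Finite (Quotient (symmetricProfiles n S)))

instance instFintypeClass (n : ℕ) (S : Type*) [Fintype S] : Fintype (Class n S) :=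
  Fintype.ofFinite _

/-! ## The game -/

/-- A game with prior `p`, signaling scheme `ψ` shared by the senders (whose signals are
conditionally independent given the state), receiver utility `uR` and the utility `uS`
common to all the senders. -/
structure Game (Θ S A : Type*) where
  prior : PMF Θ
  signal : Θ → PMF S
  uR : A → Θ → ℝ
  uS : A → Θ → ℝ
  uR_mem : ∀ a θ, uR a θ ∈ Set.Icc (0 : ℝ) 1
  uS_mem : ∀ a θ, uS a θ ∈ Set.Icc (0 : ℝ) 1

variable {n : ℕ} {Θ S A : Type*} [Fintype Θ] [Fintype S] [Fintype A]

/-- `∑_θ p(θ) u(a,θ) ψ(s|θ)`, where `ψ(s|θ) = ∏_j ψ(s_j|θ)`. -/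
def Game.weight (G : Game Θ S A) (u : A → Θ → ℝ) (s : Fin n → S) (a : A) : ℝ :=
  ∑ θ, (G.prior θ).toReal * u a θ * ∏ j, (G.signal θ (s j)).toReal

/-! ## General mechanisms and incentive compatibility -/

/-- The polytope `𝒳` of mechanisms. -/
def mechanisms (n : ℕ) (S A : Type*) [Fintype A] : Set ((Fin n → S) × A → ℝ) :=
  {x | (∀ k, 0 ≤ x k) ∧ ∀ s, ∑ a, x (s, a) = 1}

/-- Expected utility under truthful reporting, for an agent with utility function `u`. -/
def Game.utility (G : Game Θ S A) (u : A → Θ → ℝ) (x : (Fin n → S) × A → ℝ) : ℝ :=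
  ∑ s, ∑ a, x (s, a) * G.weight u s a

/-- Expected utility of sender `i` when she deviates according to `φ` and the other senders
are truthful. -/
def Game.devUtility (G : Game Θ S A) (i : Fin n) (φ : S → S) (x : (Fin n → S) × A → ℝ) : ℝ :=
  ∑ s, ∑ a, x (Function.update s i (φ (s i)), a) * G.weight G.uS s a

/-- The set `𝒳_ε` of `ε`-IC mechanisms with respect to the deviation functions `Φ`. -/
def Game.icMechanisms (G : Game Θ S A) (n : ℕ) (Φ : Finset (S → S)) (ε : ℝ) :
    Set ((Fin n → S) × A → ℝ) :=
  {x | x ∈ mechanisms n S A ∧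
    ∀ i : Fin n, ∀ φ ∈ Φ, G.devUtility i φ x - G.utility G.uS x ≤ ε}

/-- `x` is an optimal IC mechanism. -/
def Game.IsOptimalIC (G : Game Θ S A) (Φ : Finset (S → S)) (x : (Fin n → S) × A → ℝ) : Prop :=
  x ∈ G.icMechanisms n Φ 0 ∧ IsMaxOn (G.utility G.uR) (G.icMechanisms n Φ 0) x

/-! ## Symmetric mechanisms and the linear program -/

/-- The polytope `Ξ` of symmetric mechanisms. -/
def symMechanisms (n : ℕ) (S A : Type*) [Fintype A] : Set (Class n S × A → ℝ) :=
  {ξ | (∀ k, 0 ≤ ξ k) ∧ ∀ c, ∑ a, ξ (c, a) = 1}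

open Classical in
/-- The utility vector `r[c,a] = ∑_{s ∈ c} ∑_θ p(θ) u(a,θ) ψ(s|θ)`. -/
def Game.utilityVec (G : Game Θ S A) (n : ℕ) (u : A → Θ → ℝ) : Class n S × A → ℝ :=
  fun k => ∑ s : Fin n → S, if classOf s = k.1 then G.weight u s k.2 else 0

open Classical in
/-- The deviation matrix `A_i^φ` of sender `i`. -/
def devMatrixOf (A : Type*) (i : Fin n) (φ : S → S) :
    Matrix (Class n S × A) (Class n S × A) ℝ :=
  fun k k' =>
    if k.2 ≠ k'.2 then 0
    else
      (∑ s : Fin n → S, if classOf s = k'.1 ∧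
          classOf (Function.update s i (φ (s i))) = k.1 then (1 : ℝ) else 0) /
        (∑ s : Fin n → S, if classOf s = k'.1 then (1 : ℝ) else 0)

theorem classOf_comp_perm {n : ℕ} {S : Type*} (σ : Equiv.Perm (Fin n)) (s : Fin n → S) :
    classOf (s ∘ σ) = classOf s := by
  classical
  refine Quotient.sound (s := symmetricProfiles n S) fun x => ?_
  exact Equiv.sum_comp σ (fun i => if s i = x then (1 : ℕ) else 0)

/-- The deviation matrices of all the senders coincide. -/
theorem devMatrixOf_eq (A : Type*) (i j : Fin n) (φ : S → S) :
    devMatrixOf A i φ = devMatrixOf A j φ := by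
  classical
  have key : ∀ s : Fin n → S, Function.update (s ∘ Equiv.swap i j) i
      (φ ((s ∘ Equiv.swap i j) i)) = Function.update s j (φ (s j)) ∘ Equiv.swap i j := by
    intro s
    funext k
    by_cases hk : k = i
    · subst hk; simp
    · have : Equiv.swap i j k ≠ j := fun h => hk (by
        have := congrArg (Equiv.swap i j) h
        rwa [Equiv.swap_apply_self, Equiv.swap_apply_right] at this)
      simp [Function.update_of_ne hk, Function.update_of_ne this]
  ext k k'
  unfold devMatrixOf
  congr 2
  rw [← Equiv.sum_comp ((Equiv.swap i j).arrowCongr (Equiv.refl S))]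
  refine Finset.sum_congr rfl fun s _ => ?_
  have e : ((Equiv.swap i j).arrowCongr (Equiv.refl S)) s = s ∘ Equiv.swap i j := by
    funext k; simp [Equiv.arrowCongr]
  rw [e, key, classOf_comp_perm, classOf_comp_perm]

/-- The deviation matrix `A^φ` common to all the senders. -/
def devMatrix (n : ℕ) [NeZero n] {S : Type*} [Fintype S] (A : Type*) (φ : S → S) :
    Matrix (Class n S × A) (Class n S × A) ℝ :=
  devMatrixOf A (0 : Fin n) φ

/-- The feasible set of `LP(ε, rR, rS)` (it does not depend on `rR`). -/
def lpFeasible [NeZero n] (Φ : Finset (S → S)) (ε : ℝ) (rS : Class n S × A → ℝ) :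
    Set (Class n S × A → ℝ) :=
  {ξ | ξ ∈ symMechanisms n S A ∧ ∀ φ ∈ Φ, ξ ⬝ᵥ (devMatrix n A φ *ᵥ rS - rS) ≤ ε}

/-- `ξ` is an optimal solution to `LP(ε, rR, rS)`. -/
def IsLPSolution [NeZero n] (Φ : Finset (S → S)) (ε : ℝ) (rR rS ξ : Class n S × A → ℝ) : Prop :=
  ξ ∈ lpFeasible Φ ε rS ∧ IsMaxOn (fun ξ' => ξ' ⬝ᵥ rR) (lpFeasible Φ ε rS) ξ

/-! ## Bandit feedback and the algorithm -/

/-- What the receiver knows about a past round: the deterministic mechanism she used, the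
reported signal profile, the action played, and the two realized utilities. -/
structure Feedback (n : ℕ) (S A : Type*) where
  mech : Class n S → A
  profile : Fin n → S
  action : A
  uR : ℝ
  uS : ℝ

/-- A bandit-feedback algorithm: after `t` completed rounds, it selects the mechanism of the
next round from the feedback collected in those rounds. -/
def Algorithm (n : ℕ) (S A : Type*) [Fintype A] : Type _ :=
  (t : ℕ) → (Fin t → Feedback n S A) → symMechanisms n S A

open Classical in
/-- `N[c,a]`: the number of past rounds in which the deterministic mechanism used prescribes
`a` for the class `c`. -/
def count {t : ℕ} (h : Fin t → Feedback n S A) (c : Class n S) (a : A) : ℕ :=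
  ∑ τ, if (h τ).mech c = a then 1 else 0

open Classical in
/-- The estimate `r̂[c,a]` computed from the utility values `u τ` of the past rounds. -/
def estimate {t : ℕ} (h : Fin t → Feedback n S A) (u : Fin t → ℝ) : Class n S × A → ℝ :=
  fun k => (∑ τ, if (h τ).mech k.1 = k.2 then
    u τ * (if classOf (h τ).profile = k.1 then 1 else 0) else 0) / count h k.1 k.2

/-- `log (8 T |𝒞| |𝒜| / δ)`. -/
def logTerm (n : ℕ) (S A : Type*) [Fintype S] [Fintype A] (T : ℕ) (δ : ℝ) : ℝ :=
  Real.log (8 * T * Fintype.card (Class n S) * Fintype.card A / δ)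

/-- The confidence width `η[c,a]`. It is used only after the exploration rounds, when
`N[c,a] ≥ E ≥ 1` along every run. -/
def width (T : ℕ) (δ : ℝ) {t : ℕ} (h : Fin t → Feedback n S A) : Class n S × A → ℝ :=
  fun k => √(logTerm n S A T δ / (2 * count h k.1 k.2))

/-- The slack `ν` of the linear program. -/
def slack (n : ℕ) (S A : Type*) [Fintype S] [Fintype A] (T E : ℕ) (δ : ℝ) : ℝ :=
  2 * Fintype.card (Class n S) * √(logTerm n S A T δ / (2 * E))

open Classical in
/-- `alg` is an implementation of the explore-then-UCB algorithm with horizon `T`, exploration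
parameter `E` and confidence `δ`; ties in the `argmin` and among the optimal solutions of the
linear program are broken arbitrarily. The case `t < |𝒜| E` is round `t + 1`
with `t + 1 ≤ |𝒜| E`, because `t` counts the completed rounds. -/
def IsExploreThenUCB [NeZero n] (Φ : Finset (S → S)) (T E : ℕ) (δ : ℝ)
    (alg : Algorithm n S A) : Prop :=
  ∀ t < T, ∀ h : Fin t → Feedback n S A,
    (t < Fintype.card A * E →
      ∃ a, (∀ a', ∑ c, count h c a ≤ ∑ c, count h c a') ∧
        ∀ c a', (alg t h).1 (c, a') = if a' = a then 1 else 0) ∧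
    (Fintype.card A * E ≤ t →
      IsLPSolution Φ (slack n S A T E δ)
        (estimate h (fun τ => (h τ).uR) + width T δ h)
        (estimate h (fun τ => (h τ).uS)) (alg t h).1)

/-! ## The law of the interaction -/

open Classical in
/-- The product of finitely many distributions on a finite type. -/
def piPMF {ι β : Type*} [Fintype ι] [Fintype β] (μ : ι → PMF β) : PMF (ι → β) :=
  PMF.ofFintype (fun f => ∏ i, μ i (f i)) (by
    have h := Finset.prod_univ_sum (fun _ : ι => (Finset.univ : Finset β)) (fun i b => μ i b)
    rw [Fintype.piFinset_univ] at h
    rw [← h]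
    refine Finset.prod_eq_one fun i _ => ?_
    rw [← tsum_fintype (L := SummationFilter.unconditional β)]
    exact (μ i).tsum_coe)

/-- The action distribution `ξ[c,·]`. -/
def actionLaw (ξ : symMechanisms n S A) (c : Class n S) : PMF A :=
  PMF.ofFintype (fun a => ENNReal.ofReal (ξ.1 (c, a))) (by
    rw [← ENNReal.ofReal_sum_of_nonneg fun a _ => ξ.2.1 (c, a), ξ.2.2 c, ENNReal.ofReal_one])

/-- A deterministic mechanism sampled from `ξ`: independently for each class `c`, an action is
drawn from `ξ[c,·]`. -/
def sampleMech (ξ : symMechanisms n S A) : PMF (Class n S → A) :=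
  piPMF (actionLaw ξ)

/-- The outcome of a round: state of nature, signal profile and sampled deterministic mechanism. -/
abbrev Round (n : ℕ) (Θ S A : Type*) : Type _ := Θ × (Fin n → S) × (Class n S → A)

/-- The law of one round when the receiver selects `ξ`. -/
def Game.roundLaw (G : Game Θ S A) (ξ : symMechanisms n S A) : PMF (Round n Θ S A) :=
  G.prior.bind fun θ =>
    (piPMF fun _ : Fin n => G.signal θ).bind fun s =>
      (sampleMech ξ).map fun π => (θ, s, π)

/-- The feedback received after a round; the action played is `π(c(s))`. -/
def Game.feedback (G : Game Θ S A) (ω : Round n Θ S A) : Feedback n S A where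
  mech := ω.2.2
  profile := ω.2.1
  action := ω.2.2 (classOf ω.2.1)
  uR := G.uR (ω.2.2 (classOf ω.2.1)) ω.1
  uS := G.uS (ω.2.2 (classOf ω.2.1)) ω.1

/-- The mechanism selected after the rounds `h`. -/
def Game.select (G : Game Θ S A) (alg : Algorithm n S A) {t : ℕ}
    (h : Fin t → Round n Θ S A) : symMechanisms n S A :=
  alg t fun τ => G.feedback (h τ)

/-- The law of the first `t` rounds of the interaction. -/
def Game.run (G : Game Θ S A) (alg : Algorithm n S A) : (t : ℕ) → PMF (Fin t → Round n Θ S A)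
  | 0 => PMF.pure Fin.elim0
  | t + 1 => (G.run alg t).bind fun h =>
      (G.roundLaw (G.select alg h)).map fun ω => Fin.snoc (α := fun _ => Round n Θ S A) h ω

/-- The mechanism `ξ^t` selected in round `t` along the trajectory `h`. -/
def Game.played (G : Game Θ S A) (alg : Algorithm n S A) {T : ℕ}
    (h : Fin T → Round n Θ S A) (t : Fin T) : Class n S × A → ℝ :=
  (G.select alg fun τ : Fin t => h (τ.castLE t.2.le)).1

/-- The cumulative regret against the optimal IC mechanism `xOpt`. -/
def Game.regret (G : Game Θ S A) (alg : Algorithm n S A) (xOpt : (Fin n → S) × A → ℝ) {T : ℕ}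
    (h : Fin T → Round n Θ S A) : ℝ :=
  ∑ t, (G.utility G.uR xOpt - G.played alg h t ⬝ᵥ G.utilityVec n G.uR)

/-- The cumulative IC violation. -/
def Game.violation [NeZero n] (G : Game Θ S A) (Φ : Finset (S → S)) (hΦ : Φ.Nonempty)
    (alg : Algorithm n S A) {T : ℕ} (h : Fin T → Round n Θ S A) : ℝ :=
  ∑ t, Φ.sup' hΦ fun φ =>
    G.played alg h t ⬝ᵥ (devMatrix n A φ *ᵥ G.utilityVec n G.uS - G.utilityVec n G.uS)

end InfoAcq

end

set_option linter.unusedSectionVars false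

namespace InfoAcq

/-! ### Exponential moments, Chernoff bounds and product laws -/

section Probability

open scoped ENNReal

/-! With probability at least 1 - δ, every estimate formed from at least one observation is within
its confidence width of the true utility vector, and the sampled mechanisms track their means; on
this event the rest is deterministic.

Exploration rounds play constant mechanisms, which violate no IC constraint and cost regret at most
1 each; balancing the counts gives each pair (c,a) at least E observations
(`IsExploreThenUCB.le_hits`). Afterwards all widths are at most b = √(L/(2E)). Since ξᵀA^φ is again
a symmetric mechanism (`vecMul_devMatrix_mem`), an error b in r_S moves each constraint by at most
2|𝒞|b = ν, however large Φ is. So an LP solution violates the true constraints by at most 2ν, and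
every exactly IC symmetric mechanism is feasible for the estimated LP. The benchmark is of this kind
after averaging over permutations of the senders (`Game.symmetrize_mem_lpFeasible`): signals are
i.i.d. given the state and the senders share one utility, so averaging preserves both U_R and IC.

Optimism then bounds the regret of an exploitation round by 2 ξ·w with w = min(1, η)
(`IsLPSolution.regret_le`). The truncation makes arbitrary E possible: it keeps Σ_c w[c, π(c)] in
[0, |𝒞|], so a martingale bound replaces ξ·w by the widths at the sampled pairs. Those decay like
1/√N and sum to O(|𝒞||𝒜|√(TL)) (`Game.sum_weightAt_le`).

The good event comes from exponential supermartingales built on Hoeffding's lemma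
(`Game.tsum_run_exp`). Random observation counts are handled by fixing m, freezing the process after
m observations, and taking a union over m < T, both tails, both utilities and all pairs (c,a). -/

theorem tsum_bind_mul {α β : Type*} (p : PMF α) (f : α → PMF β) (g : β → ℝ≥0∞) :
    ∑' b, (p.bind f) b * g b = ∑' a, p a * ∑' b, f a b * g b := by
  simp only [PMF.bind_apply, ← ENNReal.tsum_mul_right, ← ENNReal.tsum_mul_left]
  rw [ENNReal.tsum_comm]
  simp only [mul_assoc]

theorem tsum_map_mul {α β : Type*} (p : PMF α) (f : α → β) (g : β → ℝ≥0∞) :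
    ∑' b, (p.map f) b * g b = ∑' a, p a * g (f a) := by
  rw [← PMF.bind_pure_comp, tsum_bind_mul]
  simp

theorem tsum_mul_le_one {α : Type*} (p : PMF α) (g : α → ℝ≥0∞) (hg : ∀ a, g a ≤ 1) :
    ∑' a, p a * g a ≤ 1 := by
  rw [← p.tsum_coe]
  exact ENNReal.tsum_le_tsum fun a => mul_le_of_le_one_right' (hg a)

/-- Hoeffding's lemma for a random variable on a finite type with values in `[0, B]`. -/
theorem tsum_exp_hoeffding {α : Type*} [Fintype α] (p : PMF α) (X : α → ℝ) (B : ℝ)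
    (hX : ∀ a, X a ∈ Set.Icc 0 B) (l : ℝ) :
    ∑' a, p a * ENNReal.ofReal
      (Real.exp (l * (X a - ∑ b, (p b).toReal * X b) - l ^ 2 * B ^ 2 / 8)) ≤ 1 := by
  let _ : MeasurableSpace α := ⊤
  have : MeasurableSingletonClass α := ⟨fun _ => trivial⟩
  have hm : ∫ a, X a ∂p.toMeasure = ∑ b, (p b).toReal * X b := by
    rw [PMF.integral_eq_sum]; simp
  have h := (ProbabilityTheory.hasSubgaussianMGF_of_mem_Icc (μ := p.toMeasure) (X := X)
    (a := 0) (b := B) (measurable_of_countable X).aemeasurable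
    (Filter.Eventually.of_forall hX)).mgf_le l
  rw [hm, ProbabilityTheory.mgf, PMF.integral_eq_sum] at h
  rw [tsum_fintype]
  have e : ∀ a, p a * ENNReal.ofReal
      (Real.exp (l * (X a - ∑ b, (p b).toReal * X b) - l ^ 2 * B ^ 2 / 8)) =
      ENNReal.ofReal ((p a).toReal * Real.exp (l * (X a - ∑ b, (p b).toReal * X b)) *
        Real.exp (-(l ^ 2 * B ^ 2 / 8))) := by
    intro a
    rw [mul_assoc, ENNReal.ofReal_mul ENNReal.toReal_nonneg,
      ENNReal.ofReal_toReal (p.apply_ne_top a), ← Real.exp_add, sub_eq_add_neg]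
  simp only [e]
  rw [← ENNReal.ofReal_sum_of_nonneg (fun a _ => by positivity), ← Finset.sum_mul]
  refine ENNReal.ofReal_le_one.2 ?_
  rw [Real.exp_neg, ← div_eq_mul_inv, div_le_one (Real.exp_pos _)]
  refine le_trans (le_of_eq (by simp)) (h.trans (Real.exp_le_exp.2 (le_of_eq ?_)))
  simp only [NNReal.coe_pow, NNReal.coe_div, coe_nnnorm, sub_zero, Real.norm_eq_abs, div_pow, sq_abs,
    NNReal.coe_ofNat]
  ring

/-- Chernoff's bound. -/
theorem toOuterMeasure_le_of_tsum_exp {α : Type*} (p : PMF α) (X : α → ℝ) (l : ℝ)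
    (h : ∑' a, p a * ENNReal.ofReal (Real.exp (X a)) ≤ 1) :
    p.toOuterMeasure {a | l ≤ X a} ≤ ENNReal.ofReal (Real.exp (-l)) := by
  rw [PMF.toOuterMeasure_apply]
  calc ∑' a, {a | l ≤ X a}.indicator p a
      ≤ ∑' a, p a * ENNReal.ofReal (Real.exp (X a)) * ENNReal.ofReal (Real.exp (-l)) := by
        refine ENNReal.tsum_le_tsum fun a => ?_
        by_cases ha : l ≤ X a
        · rw [Set.indicator_of_mem (by exact ha), mul_assoc,
            ← ENNReal.ofReal_mul (Real.exp_pos _).le, ← Real.exp_add]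
          refine le_mul_of_one_le_right' (ENNReal.one_le_ofReal.2 (Real.one_le_exp ?_))
          linarith
        · rw [Set.indicator_of_notMem (by exact ha)]
          exact zero_le
    _ ≤ 1 * ENNReal.ofReal (Real.exp (-l)) := by
        rw [ENNReal.tsum_mul_right]; gcongr
    _ = _ := one_mul _

theorem le_toOuterMeasure_of_compl {α : Type*} (p : PMF α) (s : Set α) {d : ℝ} (hd : 0 ≤ d)
    (h : p.toOuterMeasure sᶜ ≤ ENNReal.ofReal d) :
    ENNReal.ofReal (1 - d) ≤ p.toOuterMeasure s := by
  have h1 : p.toOuterMeasure Set.univ = 1 :=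
    (p.toOuterMeasure_apply_eq_one_iff _).2 (Set.subset_univ _)
  have h2 : (1 : ℝ≥0∞) ≤ p.toOuterMeasure s + p.toOuterMeasure sᶜ := by
    rw [← h1, ← Set.union_compl_self s]; exact MeasureTheory.measure_union_le _ _
  rw [ENNReal.ofReal_sub _ hd, ENNReal.ofReal_one]
  exact tsub_le_iff_right.2 (h2.trans (by gcongr))

theorem sum_toReal_eq_one {α : Type*} [Fintype α] (p : PMF α) : ∑ x, (p x).toReal = 1 := by
  rw [← ENNReal.toReal_sum fun b _ => p.apply_ne_top b,
    ← tsum_fintype (L := SummationFilter.unconditional α), p.tsum_coe, ENNReal.toReal_one]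

theorem piPMF_apply {ι β : Type*} [Fintype ι] [Fintype β] (μ : ι → PMF β) (f : ι → β) :
    piPMF μ f = ∏ i, μ i (f i) := rfl

open Classical in
/-- The coordinate `i` of the product distribution has law `μ i`. -/
theorem sum_piPMF_mul {ι β : Type*} [Fintype ι] [Fintype β] (μ : ι → PMF β) (i : ι)
    (g : β → ℝ) :
    ∑ f : ι → β, (piPMF μ f).toReal * g (f i) = ∑ b, (μ i b).toReal * g b := by
  have h := Finset.prod_univ_sum (fun _ : ι => (Finset.univ : Finset β))
    (fun j b => (μ j b).toReal * if j = i then g b else 1)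
  rw [Fintype.piFinset_univ] at h
  calc _ = ∑ f : ι → β, ∏ j, (μ j (f j)).toReal * (if j = i then g (f j) else 1) := by
        refine Finset.sum_congr rfl fun f _ => ?_
        rw [piPMF_apply, ENNReal.toReal_prod, Finset.prod_mul_distrib]
        simp
    _ = ∏ j, ∑ b, (μ j b).toReal * (if j = i then g b else 1) := h.symm
    _ = ∏ j, if j = i then ∑ b, (μ j b).toReal * g b else 1 := by
        refine Finset.prod_congr rfl fun j _ => ?_
        split_ifs <;> simp [sum_toReal_eq_one]
    _ = _ := by simp

end Probability
-- The law of the interaction and its exponential supermartingales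
section Law

open scoped ENNReal
open Classical

variable {n : ℕ} {Θ S A : Type*} [Fintype Θ] [Fintype S] [Fintype A]

/-- An adapted process of exponents with conditional exponential moments at most `1` has a
product of exponentials with expectation at most `1`. -/
theorem Game.tsum_run_exp (G : Game Θ S A) (alg : Algorithm n S A)
    (D : (t : ℕ) → (Fin t → Round n Θ S A) → Round n Θ S A → ℝ)
    (hD : ∀ t h, ∑' ω, G.roundLaw (G.select alg h) ω * ENNReal.ofReal (Real.exp (D t h ω)) ≤ 1)
    (T : ℕ) :
    ∑' h, G.run alg T h * ENNReal.ofReal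
      (Real.exp (∑ t : Fin T, D t (fun i : Fin t => h (i.castLE t.2.le)) (h t))) ≤ 1 := by
  induction T with
  | zero => exact tsum_mul_le_one _ _ fun h => by simp
  | succ T ih =>
    rw [Game.run, tsum_bind_mul]
    -- Tower property: conditionally on the first T rounds, the factor of the last round has
    -- expectation at most 1.
    refine le_trans (ENNReal.tsum_le_tsum fun h => ?_) ih
    gcongr
    rw [tsum_map_mul]
    have e : ∀ ω : Round n Θ S A, (∑ t : Fin (T + 1), D t
        (fun i : Fin t => (Fin.snoc h ω : Fin (T + 1) → Round n Θ S A) (i.castLE t.2.le))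
        ((Fin.snoc h ω : Fin (T + 1) → Round n Θ S A) t)) =
        (∑ t : Fin T, D t (fun i : Fin t => h (i.castLE t.2.le)) (h t)) + D T h ω := by
      intro ω
      have hs : ∀ {m : ℕ} (hm : m ≤ T) (i : Fin m),
          (Fin.snoc h ω : Fin (T + 1) → Round n Θ S A) (i.castLE (hm.trans T.le_succ)) =
            h (i.castLE hm) := fun hm i =>
        Fin.snoc_castSucc (α := fun _ => Round n Θ S A) ω h (i.castLE hm)
      rw [Fin.sum_univ_castSucc]
      congr 1
      · refine Finset.sum_congr rfl fun t _ => ?_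
        rw [Fin.snoc_castSucc (α := fun _ => Round n Θ S A)]
        congr 1
        funext i
        exact hs t.2.le i
      · rw [Fin.snoc_last (α := fun _ => Round n Θ S A)]
        congr 1
        funext i
        exact hs le_rfl i
    simp only [e, Real.exp_add, ENNReal.ofReal_mul (Real.exp_pos _).le]
    calc _ = ENNReal.ofReal (Real.exp (∑ t : Fin T, D t (fun i : Fin t => h (i.castLE t.2.le)) (h t)))
          * ∑' ω, G.roundLaw (G.select alg h) ω * ENNReal.ofReal (Real.exp (D T h ω)) := by
          rw [← ENNReal.tsum_mul_left]
          exact tsum_congr fun ω => mul_left_comm _ _ _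
      _ ≤ _ := mul_le_of_le_one_right' (hD T h)

/-- Almost surely, every mechanism used belongs to the support of the selected one. -/
theorem Game.played_ne_zero_of_mem_support (G : Game Θ S A) (alg : Algorithm n S A) (T : ℕ)
    (h : Fin T → Round n Θ S A) (hh : h ∈ (G.run alg T).support) (t : Fin T) (c : Class n S) :
    G.played alg h t (c, (h t).2.2 c) ≠ 0 := by
  induction T with
  | zero => exact t.elim0
  | succ T ih =>
    rw [Game.run, PMF.mem_support_bind_iff] at hh
    obtain ⟨h', hh', hm⟩ := hh
    rw [PMF.mem_support_map_iff] at hm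
    obtain ⟨ω, hω, rfl⟩ := hm
    have hs : ∀ {m : ℕ} (hm : m ≤ T) (i : Fin m),
        (Fin.snoc h' ω : Fin (T + 1) → Round n Θ S A) (i.castLE (hm.trans T.le_succ)) =
          h' (i.castLE hm) := fun hm i =>
      Fin.snoc_castSucc (α := fun _ => Round n Θ S A) ω h' (i.castLE hm)
    refine Fin.lastCases ?_ (fun t => ?_) t
    · have e : (fun i : Fin T => (Fin.snoc h' ω : Fin (T + 1) → Round n Θ S A)
          (i.castLE T.le_succ)) = h' := funext fun i => hs le_rfl i
      rw [Fin.snoc_last (α := fun _ => Round n Θ S A)]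
      show (G.select alg (fun i : Fin T => (Fin.snoc h' ω : Fin (T + 1) → Round n Θ S A)
          (i.castLE T.le_succ))).1 (c, ω.2.2 c) ≠ 0
      rw [e]
      simp only [Game.roundLaw, PMF.mem_support_bind_iff, PMF.mem_support_map_iff] at hω
      obtain ⟨θ, -, s, -, π, hπ, rfl⟩ := hω
      rw [PMF.mem_support_iff, sampleMech, piPMF_apply, Finset.prod_ne_zero_iff] at hπ
      intro h0
      refine hπ c (Finset.mem_univ c) ?_
      show ENNReal.ofReal _ = 0
      rw [h0, ENNReal.ofReal_zero]
    · have := ih h' hh' t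
      rw [Fin.snoc_castSucc (α := fun _ => Round n Θ S A)]
      have e : (fun i : Fin t => (Fin.snoc h' ω : Fin (T + 1) → Round n Θ S A)
          (i.castLE (t.2.le.trans T.le_succ))) = fun i : Fin t => h' (i.castLE t.2.le) :=
        funext fun i => hs t.2.le i
      show (G.select alg (fun i : Fin t => (Fin.snoc h' ω : Fin (T + 1) → Round n Θ S A)
          (i.castLE (t.2.le.trans T.le_succ)))).1 (c, (h' t).2.2 c) ≠ 0
      rw [e]
      exact this

/-- The law of the state and the signal profile. -/
noncomputable def Game.stateLaw (G : Game Θ S A) (n : ℕ) : PMF (Θ × (Fin n → S)) :=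
  G.prior.bind fun θ => (piPMF fun _ : Fin n => G.signal θ).map fun s => (θ, s)

/-- The mechanism is drawn independently of the state and the signals, so it may be drawn first.
This allows conditioning on π. -/
theorem Game.tsum_roundLaw_mul (G : Game Θ S A) (ξ : symMechanisms n S A)
    (g : Round n Θ S A → ℝ≥0∞) :
    ∑' ω, G.roundLaw ξ ω * g ω =
      ∑' π, sampleMech ξ π * ∑' q, G.stateLaw n q * g (q.1, q.2, π) := by
  simp only [Game.roundLaw, Game.stateLaw, tsum_bind_mul, tsum_map_mul, ← ENNReal.tsum_mul_left]
  conv_rhs => rw [ENNReal.tsum_comm]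
  refine tsum_congr fun θ => ?_
  conv_rhs => rw [ENNReal.tsum_comm]
  refine tsum_congr fun s => tsum_congr fun π => ?_
  ring

theorem Game.stateLaw_apply (G : Game Θ S A) (q : Θ × (Fin n → S)) :
    (G.stateLaw n q).toReal = (G.prior q.1).toReal * ∏ j, (G.signal q.1 (q.2 j)).toReal := by
  obtain ⟨θ, s⟩ := q
  have : G.stateLaw n (θ, s) = G.prior θ * ∏ j, G.signal θ (s j) := by
    rw [Game.stateLaw, PMF.bind_apply, tsum_eq_single θ]
    · rw [PMF.map_apply, tsum_eq_single s]
      · simp [piPMF_apply]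
      · intro s' hs'; simp [hs'.symm]
    · intro θ' hθ'
      rw [PMF.map_apply]
      simp [hθ'.symm]
  rw [this, ENNReal.toReal_mul, ENNReal.toReal_prod]

/-- This is why the estimates are unbiased: the utility of a, masked by the indicator of the class
c, has mean r[c,a]. -/
theorem Game.sum_stateLaw_mul (G : Game Θ S A) (u : A → Θ → ℝ) (c : Class n S) (a : A) :
    ∑ q : Θ × (Fin n → S), (G.stateLaw n q).toReal *
      (u a q.1 * if classOf q.2 = c then 1 else 0) = G.utilityVec n u (c, a) := by
  rw [Fintype.sum_prod_type, Finset.sum_comm]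
  simp only [Game.stateLaw_apply, Game.utilityVec, Game.weight]
  refine Finset.sum_congr rfl fun s _ => ?_
  split_ifs
  · exact Finset.sum_congr rfl fun θ _ => by ring
  · simp

/-- The exponential moments of the error of the estimate of `r[c,a]`, for a round law. -/
theorem Game.tsum_roundLaw_exp_estimate (G : Game Θ S A) (ξ : symMechanisms n S A)
    (u : A → Θ → ℝ) (hu : ∀ a θ, u a θ ∈ Set.Icc (0 : ℝ) 1) (c : Class n S) (a : A)
    (P : Prop) [Decidable P] (l : ℝ) :
    ∑' ω, G.roundLaw ξ ω * ENNReal.ofReal (Real.exp (if ω.2.2 c = a ∧ P then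
      l * (u (ω.2.2 (classOf ω.2.1)) ω.1 * (if classOf ω.2.1 = c then 1 else 0) -
        G.utilityVec n u (c, a)) - l ^ 2 / 8 else 0)) ≤ 1 := by
  rw [Game.tsum_roundLaw_mul]
  refine tsum_mul_le_one _ _ fun π => ?_
  by_cases hπ : π c = a ∧ P
  · simp only [hπ]
    -- The action played is π(c(s)), but the indicator only keeps profiles in c, where it equals
    -- π(c) = a.
    have hX : ∀ q : Θ × (Fin n → S),
        u (π (classOf q.2)) q.1 * (if classOf q.2 = c then 1 else 0) =
        u a q.1 * if classOf q.2 = c then 1 else 0 := by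
      intro q
      split_ifs with h
      · rw [h, hπ.1]
      · simp
    simp only [hX, ← Game.sum_stateLaw_mul, true_and, if_true]
    have := tsum_exp_hoeffding (G.stateLaw n)
      (fun q => u a q.1 * if classOf q.2 = c then 1 else 0) 1 (fun q => by
        have := hu a q.1
        split_ifs <;> simp_all) l
    simpa using this
  · simp only [hπ, if_false]
    exact tsum_mul_le_one _ _ fun q => by simp

/-- The exponential moments of the deviation of the sampled mechanism from its mean. -/
theorem Game.tsum_roundLaw_exp_sample (G : Game Θ S A) (ξ : symMechanisms n S A)
    (w : Class n S × A → ℝ) (hw : ∀ k, w k ∈ Set.Icc (0 : ℝ) 1) (l : ℝ) :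
    ∑' ω, G.roundLaw ξ ω * ENNReal.ofReal (Real.exp (l * (ξ.1 ⬝ᵥ w - ∑ c, w (c, ω.2.2 c)) -
      l ^ 2 * (Fintype.card (Class n S) : ℝ) ^ 2 / 8)) ≤ 1 := by
  rw [Game.tsum_roundLaw_mul]
  have hmean : ∑ π, (sampleMech ξ π).toReal * ∑ c, w (c, π c) = ξ.1 ⬝ᵥ w := by
    simp only [Finset.mul_sum]
    rw [Finset.sum_comm, dotProduct, Fintype.sum_prod_type]
    refine Finset.sum_congr rfl fun c _ => ?_
    rw [sampleMech, sum_piPMF_mul (actionLaw ξ) c (fun a => w (c, a))]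
    refine Finset.sum_congr rfl fun a _ => ?_
    show (ENNReal.ofReal _).toReal * _ = _
    rw [ENNReal.toReal_ofReal (ξ.2.1 _)]
  -- The exponent has the mean minus the sample, hence the sign -l.
  have := tsum_exp_hoeffding (sampleMech ξ) (fun π => ∑ c, w (c, π c))
    (Fintype.card (Class n S)) (fun π => ⟨Finset.sum_nonneg fun c _ => (hw _).1, by
      refine (Finset.sum_le_sum fun c _ => (hw (c, π c)).2).trans ?_
      simp⟩) (-l)
  rw [hmean] at this
  refine le_trans (ENNReal.tsum_le_tsum fun π => ?_) this
  gcongr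
  refine le_trans (b := ENNReal.ofReal (Real.exp (l * (ξ.1 ⬝ᵥ w - ∑ c, w (c, π c)) -
      l ^ 2 * (Fintype.card (Class n S) : ℝ) ^ 2 / 8)))
    (by dsimp only; rw [ENNReal.tsum_mul_right, PMF.tsum_coe, one_mul]) ?_
  refine ENNReal.ofReal_le_ofReal (Real.exp_le_exp.2 (le_of_eq ?_))
  ring

end Law
-- Symmetrization of mechanisms and the deviation matrices
section Symmetric

open scoped Matrix
open Classical

variable {n : ℕ} {Θ S A : Type*} [Fintype Θ] [Fintype S] [Fintype A]

/-- For each signal, the senders reporting it in the two profiles are equally many; bijections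
between these fibres glue to a permutation of the senders. -/
theorem exists_perm_of_classOf_eq {n : ℕ} {S : Type*} {s s' : Fin n → S} (h : classOf s = classOf s') :
    ∃ σ : Equiv.Perm (Fin n), s' = s ∘ σ := by
  have hr : ∀ x : S, (∑ i, if s i = x then 1 else 0 : ℕ) = ∑ i, if s' i = x then 1 else 0 :=
    Quotient.exact h
  have hc : ∀ x : S, Nonempty ({i // s' i = x} ≃ {i // s i = x}) := fun x => by
    refine ⟨Fintype.equivOfCardEq ?_⟩
    rw [Fintype.card_subtype, Fintype.card_subtype, Finset.card_filter, Finset.card_filter]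
    exact (hr x).symm
  let e := fun x => Classical.choice (hc x)
  refine ⟨(Equiv.sigmaFiberEquiv s').symm.trans
    ((Equiv.sigmaCongrRight e).trans (Equiv.sigmaFiberEquiv s)), funext fun i => ?_⟩
  exact ((e (s' i)) ⟨i, rfl⟩).2.symm

theorem Game.weight_comp_perm (G : Game Θ S A) (u : A → Θ → ℝ) (s : Fin n → S) (a : A)
    (σ : Equiv.Perm (Fin n)) : G.weight u (s ∘ σ) a = G.weight u s a := by
  unfold Game.weight
  refine Finset.sum_congr rfl fun θ _ => ?_
  congr 1
  exact Equiv.prod_comp σ fun j => (G.signal θ (s j)).toReal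

theorem Game.weight_eq_of_classOf_eq (G : Game Θ S A) (u : A → Θ → ℝ) {s s' : Fin n → S}
    (h : classOf s = classOf s') (a : A) : G.weight u s a = G.weight u s' a := by
  obtain ⟨σ, rfl⟩ := exists_perm_of_classOf_eq h
  rw [G.weight_comp_perm]

/-- The mechanism on signal profiles given by a symmetric mechanism. -/
def liftMech (ξ : Class n S × A → ℝ) : (Fin n → S) × A → ℝ := fun k => ξ (classOf k.1, k.2)

theorem Game.dotProduct_utilityVec (G : Game Θ S A) (u : A → Θ → ℝ) (ξ : Class n S × A → ℝ) :
    ξ ⬝ᵥ G.utilityVec n u = G.utility u (liftMech ξ) := by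
  simp only [dotProduct, Game.utilityVec, Game.utility, liftMech, Fintype.sum_prod_type,
    Finset.mul_sum]
  rw [Finset.sum_comm]
  conv_rhs => rw [Finset.sum_comm]
  refine Finset.sum_congr rfl fun a _ => ?_
  rw [Finset.sum_comm]
  refine Finset.sum_congr rfl fun s _ => ?_
  simp

/-- The weight is constant on each class, so r_S[c',a] is |c'| times the weight of any profile in
c', and the factor |c'| cancels the denominator of the matrix entry. -/
theorem Game.dotProduct_devMatrixOf_mulVec (G : Game Θ S A) (i : Fin n) (φ : S → S)
    (ξ : Class n S × A → ℝ) :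
    ξ ⬝ᵥ (devMatrixOf A i φ *ᵥ G.utilityVec n G.uS) = G.devUtility i φ (liftMech ξ) := by
  have key : ∀ (c c' : Class n S) (a : A),
      devMatrixOf A i φ (c, a) (c', a) * G.utilityVec n G.uS (c', a) =
        ∑ s : Fin n → S, if classOf s = c' ∧ classOf (Function.update s i (φ (s i))) = c
          then G.weight G.uS s a else 0 := by
    intro c c' a
    obtain ⟨s₀, rfl⟩ := Quotient.exists_rep c'
    change devMatrixOf A i φ (c, a) (classOf s₀, a) * G.utilityVec n G.uS (classOf s₀, a) =
      ∑ s : Fin n → S, if classOf s = classOf s₀ ∧ _ then _ else _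
    have h1 : G.utilityVec n G.uS (classOf s₀, a) =
        (∑ s : Fin n → S, if classOf s = classOf s₀ then (1 : ℝ) else 0) *
          G.weight G.uS s₀ a := by
      simp only [Game.utilityVec, Finset.sum_mul, ite_mul, one_mul, zero_mul]
      refine Finset.sum_congr rfl fun s _ => ?_
      split_ifs with h
      · exact G.weight_eq_of_classOf_eq _ h a
      · rfl
    have h2 : (∑ s : Fin n → S, if classOf s = classOf s₀ then (1 : ℝ) else 0) ≠ 0 := by
      refine (Finset.sum_pos' (fun s _ => by positivity) ⟨s₀, Finset.mem_univ _, by simp⟩).ne'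
    rw [h1, devMatrixOf]
    simp only [ne_eq, not_true_eq_false, if_false]
    rw [← mul_assoc, div_mul_cancel₀ _ h2, Finset.sum_mul]
    refine Finset.sum_congr rfl fun s _ => ?_
    split_ifs with h
    · rw [one_mul, G.weight_eq_of_classOf_eq _ h.1 a]
    · rw [zero_mul]
  have hA : ∀ (c c' : Class n S) (a a' : A), a ≠ a' →
      devMatrixOf A i φ (c, a) (c', a') = 0 := fun c c' a a' h => by
    simp [devMatrixOf, h]
  have hrow : ∀ c a, (devMatrixOf A i φ *ᵥ G.utilityVec n G.uS) (c, a) =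
      ∑ s : Fin n → S, if classOf (Function.update s i (φ (s i))) = c
          then G.weight G.uS s a else 0 := by
    intro c a
    rw [Matrix.mulVec, dotProduct, Fintype.sum_prod_type]
    have : ∀ c' : Class n S, ∑ a', devMatrixOf A i φ (c, a) (c', a') *
        G.utilityVec n G.uS (c', a') = ∑ s : Fin n → S, if classOf s = c' ∧
          classOf (Function.update s i (φ (s i))) = c then G.weight G.uS s a else 0 := by
      intro c'
      rw [Finset.sum_eq_single a, key]
      · intro a' _ h
        rw [hA _ _ _ _ h.symm, zero_mul]
      · simp
    simp only [this]
    rw [Finset.sum_comm]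
    refine Finset.sum_congr rfl fun s _ => ?_
    simp [ite_and]
  simp only [dotProduct, Fintype.sum_prod_type, hrow, Game.devUtility, liftMech, Finset.mul_sum]
  rw [Finset.sum_comm]
  conv_rhs => rw [Finset.sum_comm]
  refine Finset.sum_congr rfl fun a _ => ?_
  rw [Finset.sum_comm]
  refine Finset.sum_congr rfl fun s _ => ?_
  simp

/-- The average of a mechanism over the permutations of the senders. -/
noncomputable def symmetrize (x : (Fin n → S) × A → ℝ) : Class n S × A → ℝ :=
  fun k => (∑ σ : Equiv.Perm (Fin n), x (k.1.out ∘ σ, k.2)) /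
    Fintype.card (Equiv.Perm (Fin n))

theorem liftMech_symmetrize (x : (Fin n → S) × A → ℝ) (s : Fin n → S) (a : A) :
    liftMech (symmetrize x) (s, a) =
      (∑ σ : Equiv.Perm (Fin n), x (s ∘ σ, a)) / Fintype.card (Equiv.Perm (Fin n)) := by
  obtain ⟨τ, hτ⟩ := exists_perm_of_classOf_eq (s := s) (s' := (classOf s).out)
    (Quotient.out_eq (classOf s)).symm
  unfold liftMech symmetrize
  congr 1
  dsimp only
  rw [hτ]
  exact Equiv.sum_comp (Equiv.mulLeft τ) fun σ => x (s ∘ σ, a)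

theorem symmetrize_mem {x : (Fin n → S) × A → ℝ} (hx : x ∈ mechanisms n S A) :
    symmetrize x ∈ symMechanisms n S A := by
  refine ⟨fun k => div_nonneg (Finset.sum_nonneg fun σ _ => hx.1 _) (Nat.cast_nonneg _),
    fun c => ?_⟩
  unfold symmetrize
  rw [← Finset.sum_div, Finset.sum_comm]
  simp only [hx.2]
  simp

theorem Game.utility_comp_perm (G : Game Θ S A) (u : A → Θ → ℝ) (x : (Fin n → S) × A → ℝ)
    (σ : Equiv.Perm (Fin n)) :
    G.utility u (fun k => x (k.1 ∘ σ, k.2)) = G.utility u x := by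
  unfold Game.utility
  rw [← Equiv.sum_comp (σ.symm.arrowCongr (Equiv.refl S))
    (fun s => ∑ a, x (s, a) * G.weight u s a)]
  refine Finset.sum_congr rfl fun s _ => Finset.sum_congr rfl fun a _ => ?_
  have e : (σ.symm.arrowCongr (Equiv.refl S)) s = s ∘ σ := rfl
  rw [e, G.weight_comp_perm]

/-- Permuting the senders turns a deviation of one sender into the same deviation of another. IC for
all senders is therefore what makes the averaged mechanism IC. -/
theorem Game.devUtility_comp_perm (G : Game Θ S A) (i : Fin n) (φ : S → S)
    (x : (Fin n → S) × A → ℝ) (σ : Equiv.Perm (Fin n)) :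
    G.devUtility i φ (fun k => x (k.1 ∘ σ, k.2)) = G.devUtility (σ.symm i) φ x := by
  unfold Game.devUtility
  rw [← Equiv.sum_comp (σ.symm.arrowCongr (Equiv.refl S)) (fun s => ∑ a,
    x (Function.update s (σ.symm i) (φ (s (σ.symm i))), a) * G.weight G.uS s a)]
  refine Finset.sum_congr rfl fun s _ => Finset.sum_congr rfl fun a _ => ?_
  have e : (σ.symm.arrowCongr (Equiv.refl S)) s = s ∘ σ := rfl
  rw [e, G.weight_comp_perm, Function.comp_apply, Equiv.apply_symm_apply,
    ← Function.update_comp_equiv]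

theorem Game.utility_liftMech_symmetrize (G : Game Θ S A) (u : A → Θ → ℝ)
    (x : (Fin n → S) × A → ℝ) : G.utility u (liftMech (symmetrize x)) = G.utility u x := by
  have h : G.utility u (liftMech (symmetrize x)) =
      (∑ σ : Equiv.Perm (Fin n), G.utility u (fun k => x (k.1 ∘ σ, k.2))) /
        Fintype.card (Equiv.Perm (Fin n)) := by
    simp only [Game.utility, liftMech_symmetrize, Finset.sum_div, Finset.sum_mul]
    rw [Finset.sum_comm (s := (Finset.univ : Finset (Equiv.Perm (Fin n))))]
    refine Finset.sum_congr rfl fun s _ => ?_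
    rw [Finset.sum_comm]
    exact Finset.sum_congr rfl fun σ _ => Finset.sum_congr rfl fun a _ => by ring
  rw [h]
  simp [G.utility_comp_perm]

theorem Game.devUtility_liftMech_symmetrize (G : Game Θ S A) (i : Fin n) (φ : S → S)
    (x : (Fin n → S) × A → ℝ) : G.devUtility i φ (liftMech (symmetrize x)) =
      (∑ σ : Equiv.Perm (Fin n), G.devUtility (σ.symm i) φ x) /
        Fintype.card (Equiv.Perm (Fin n)) := by
  simp only [← G.devUtility_comp_perm]
  simp only [Game.devUtility, liftMech_symmetrize, Finset.sum_div, Finset.sum_mul]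
  rw [Finset.sum_comm (s := (Finset.univ : Finset (Equiv.Perm (Fin n))))]
  refine Finset.sum_congr rfl fun s _ => ?_
  rw [Finset.sum_comm]
  exact Finset.sum_congr rfl fun σ _ => Finset.sum_congr rfl fun a _ => by ring

/-- Symmetrizing an incentive compatible mechanism preserves the receiver's utility and
incentive compatibility. -/
theorem Game.symmetrize_mem_lpFeasible [NeZero n] (G : Game Θ S A) (Φ : Finset (S → S))
    {x : (Fin n → S) × A → ℝ} (hx : x ∈ G.icMechanisms n Φ 0) :
    symmetrize x ∈ lpFeasible Φ 0 (G.utilityVec n G.uS) ∧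
      symmetrize x ⬝ᵥ G.utilityVec n G.uR = G.utility G.uR x := by
  refine ⟨⟨symmetrize_mem hx.1, fun φ hφ => ?_⟩, by
    rw [G.dotProduct_utilityVec, G.utility_liftMech_symmetrize]⟩
  rw [dotProduct_sub, devMatrix, G.dotProduct_devMatrixOf_mulVec, G.dotProduct_utilityVec,
    G.utility_liftMech_symmetrize, G.devUtility_liftMech_symmetrize, sub_nonpos]
  rw [div_le_iff₀ (by exact_mod_cast Fintype.card_pos)]
  refine (Finset.sum_le_sum fun σ _ => ?_).trans_eq
    (b := ∑ _σ : Equiv.Perm (Fin n), G.utility G.uS x) ?_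
  · have := hx.2 (σ.symm 0) φ hφ
    linarith
  · rw [Finset.sum_const, Finset.card_univ, nsmul_eq_mul, mul_comm]

/-- A mechanism that always plays the action `a` leaves nothing to gain by deviating. -/
theorem Game.violation_const [NeZero n] (G : Game Θ S A) (φ : S → S)
    {ξ : Class n S × A → ℝ} {a : A} (h : ∀ c a', ξ (c, a') = if a' = a then 1 else 0) :
    ξ ⬝ᵥ (devMatrix n A φ *ᵥ G.utilityVec n G.uS - G.utilityVec n G.uS) = 0 := by
  rw [dotProduct_sub, devMatrix, G.dotProduct_devMatrixOf_mulVec, G.dotProduct_utilityVec,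
    sub_eq_zero]
  unfold Game.devUtility Game.utility liftMech
  simp only [h]

/-- The probability of a class of signal profiles. -/
noncomputable def Game.classProb (G : Game Θ S A) (n : ℕ) (c : Class n S) : ℝ :=
  ∑ s : Fin n → S, if classOf s = c then
    ∑ θ, (G.prior θ).toReal * ∏ j, (G.signal θ (s j)).toReal else 0

theorem Game.sum_classProb (G : Game Θ S A) : ∑ c, G.classProb n c = 1 := by
  unfold Game.classProb
  rw [Finset.sum_comm]
  simp only [Finset.sum_ite_eq, Finset.mem_univ, if_true]
  rw [Finset.sum_comm]
  simp only [← Finset.mul_sum]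
  have h : ∀ θ, ∑ s : Fin n → S, ∏ j, (G.signal θ (s j)).toReal = 1 := fun θ => by
    have h := Finset.prod_univ_sum (fun _ : Fin n => (Finset.univ : Finset S))
      (fun _ b => (G.signal θ b).toReal)
    rw [Fintype.piFinset_univ] at h
    rw [← h]
    simp [sum_toReal_eq_one]
  simp [h, sum_toReal_eq_one]

theorem Game.utilityVec_nonneg (G : Game Θ S A) (u : A → Θ → ℝ)
    (hu : ∀ a θ, u a θ ∈ Set.Icc (0 : ℝ) 1) (k : Class n S × A) : 0 ≤ G.utilityVec n u k := by
  refine Finset.sum_nonneg fun s _ => ?_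
  split_ifs
  · exact Finset.sum_nonneg fun θ _ => mul_nonneg (mul_nonneg ENNReal.toReal_nonneg (hu _ _).1)
      (Finset.prod_nonneg fun j _ => ENNReal.toReal_nonneg)
  · exact le_rfl

/-- Bounding by the class probability, rather than by 1, is what keeps ξ·r below 1 instead of |𝒞|.
-/
theorem Game.utilityVec_le_classProb (G : Game Θ S A) (u : A → Θ → ℝ)
    (hu : ∀ a θ, u a θ ∈ Set.Icc (0 : ℝ) 1) (k : Class n S × A) :
    G.utilityVec n u k ≤ G.classProb n k.1 := by
  refine Finset.sum_le_sum fun s _ => ?_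
  split_ifs
  · exact Finset.sum_le_sum fun θ _ => mul_le_mul_of_nonneg_right
      (mul_le_of_le_one_right ENNReal.toReal_nonneg (hu _ _).2)
      (Finset.prod_nonneg fun j _ => ENNReal.toReal_nonneg)
  · exact le_rfl

theorem Game.classProb_nonneg (G : Game Θ S A) (c : Class n S) : 0 ≤ G.classProb n c := by
  refine Finset.sum_nonneg fun s _ => ?_
  split_ifs
  · exact Finset.sum_nonneg fun θ _ => mul_nonneg ENNReal.toReal_nonneg
      (Finset.prod_nonneg fun j _ => ENNReal.toReal_nonneg)
  · exact le_rfl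

theorem Game.utilityVec_le_one (G : Game Θ S A) (u : A → Θ → ℝ)
    (hu : ∀ a θ, u a θ ∈ Set.Icc (0 : ℝ) 1) (k : Class n S × A) : G.utilityVec n u k ≤ 1 := by
  refine (G.utilityVec_le_classProb u hu k).trans ?_
  rw [← G.sum_classProb (n := n)]
  exact Finset.single_le_sum (fun c _ => G.classProb_nonneg c) (Finset.mem_univ k.1)

theorem Game.dotProduct_utilityVec_mem (G : Game Θ S A) (u : A → Θ → ℝ)
    (hu : ∀ a θ, u a θ ∈ Set.Icc (0 : ℝ) 1) {ξ : Class n S × A → ℝ}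
    (hξ : ξ ∈ symMechanisms n S A) : ξ ⬝ᵥ G.utilityVec n u ∈ Set.Icc (0 : ℝ) 1 := by
  refine ⟨Finset.sum_nonneg fun k _ => mul_nonneg (hξ.1 k) (G.utilityVec_nonneg u hu k), ?_⟩
  rw [dotProduct, Fintype.sum_prod_type, ← G.sum_classProb (n := n)]
  refine Finset.sum_le_sum fun c _ => ?_
  calc _ ≤ ∑ a, ξ (c, a) * G.classProb n c := Finset.sum_le_sum fun a _ =>
        mul_le_mul_of_nonneg_left (G.utilityVec_le_classProb u hu _) (hξ.1 _)
    _ = _ := by rw [← Finset.sum_mul, hξ.2, one_mul]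

theorem dotProduct_le_of_mem {ξ : Class n S × A → ℝ} (hξ : ξ ∈ symMechanisms n S A)
    {v : Class n S × A → ℝ} {b : ℝ} (hv : ∀ k, v k ≤ b) :
    ξ ⬝ᵥ v ≤ Fintype.card (Class n S) * b := by
  rw [dotProduct, Fintype.sum_prod_type]
  calc _ ≤ ∑ c : Class n S, ∑ a, ξ (c, a) * b := Finset.sum_le_sum fun c _ =>
        Finset.sum_le_sum fun a _ => mul_le_mul_of_nonneg_left (hv _) (hξ.1 _)
    _ = _ := by
        simp only [← Finset.sum_mul, hξ.2]
        simp

/-- The product is the play that ξ induces when a profile uniform in c' is misreported: for fixed c'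
and a the entries form a probability distribution over c, and this distribution does not depend on
a. -/
theorem vecMul_devMatrix_mem [NeZero n] (φ : S → S) {ξ : Class n S × A → ℝ}
    (hξ : ξ ∈ symMechanisms n S A) : ξ ᵥ* devMatrix n A φ ∈ symMechanisms n S A := by
  have h0 : ∀ k k', 0 ≤ devMatrix n A φ k k' := fun k k' => by
    unfold devMatrix devMatrixOf
    split_ifs
    · exact le_rfl
    · positivity
  have h1 : ∀ (c' : Class n S) (a : A), ∑ c, devMatrix n A φ (c, a) (c', a) = 1 := fun c' a => by
    obtain ⟨s₀, rfl⟩ := Quotient.exists_rep c'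
    change ∑ c, devMatrix n A φ (c, a) (classOf s₀, a) = 1
    have h2 : (∑ s : Fin n → S, if classOf s = classOf s₀ then (1 : ℝ) else 0) ≠ 0 :=
      (Finset.sum_pos' (fun s _ => by positivity) ⟨s₀, Finset.mem_univ _, by simp⟩).ne'
    simp only [devMatrix, devMatrixOf, ne_eq, not_true_eq_false, if_false]
    rw [← Finset.sum_div, Finset.sum_comm, div_eq_one_iff_eq h2]
    refine Finset.sum_congr rfl fun s _ => ?_
    simp [ite_and]
  refine ⟨fun k => Finset.sum_nonneg fun k' _ => mul_nonneg (hξ.1 _) (h0 _ _), fun c' => ?_⟩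
  have h3 : ∀ a, (ξ ᵥ* devMatrix n A φ) (c', a) =
      ∑ c, ξ (c, a) * devMatrix n A φ (c, a) (c', a) := fun a => by
    rw [Matrix.vecMul, dotProduct, Fintype.sum_prod_type]
    refine Finset.sum_congr rfl fun c _ => Finset.sum_eq_single a (fun a' _ h => ?_) (by simp)
    simp [devMatrix, devMatrixOf, h]
  have h4 : ∀ (c : Class n S) (a a' : A),
      devMatrix n A φ (c, a) (c', a) = devMatrix n A φ (c, a') (c', a') := fun c a a' => by
    simp [devMatrix, devMatrixOf]
  simp only [h3]
  rw [Finset.sum_comm]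
  rcases isEmpty_or_nonempty A with hA | ⟨⟨a₀⟩⟩
  · simpa using hξ.2 c'
  · simp only [h4 _ _ a₀, ← Finset.sum_mul, hξ.2, one_mul, h1]

theorem dotProduct_devMatrix_mulVec_le [NeZero n] (φ : S → S) {ξ : Class n S × A → ℝ}
    (hξ : ξ ∈ symMechanisms n S A) {v : Class n S × A → ℝ} {b : ℝ} (hv : ∀ k, v k ≤ b) :
    ξ ⬝ᵥ (devMatrix n A φ *ᵥ v) ≤ Fintype.card (Class n S) * b := by
  rw [Matrix.dotProduct_mulVec]
  exact dotProduct_le_of_mem (vecMul_devMatrix_mem φ hξ) hv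

end Symmetric
-- Stability and optimism of the linear program
section LinearProgram

open scoped Matrix
open Classical

variable {n : ℕ} {S A : Type*} [Fintype S] [Fintype A]

/-- The errors enter once through ξᵀA^φ and once through ξ. Both are symmetric mechanisms, of total
mass |𝒞|, so each contributes at most |𝒞|b. -/
theorem dotProduct_dev_le [NeZero n] (φ : S → S) {ξ : Class n S × A → ℝ}
    (hξ : ξ ∈ symMechanisms n S A) {r r' : Class n S × A → ℝ} {b : ℝ}
    (h : ∀ k, |r' k - r k| ≤ b) :
    ξ ⬝ᵥ (devMatrix n A φ *ᵥ r' - r') ≤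
      ξ ⬝ᵥ (devMatrix n A φ *ᵥ r - r) + 2 * Fintype.card (Class n S) * b := by
  have h1 := dotProduct_devMatrix_mulVec_le φ hξ (v := r' - r)
    (fun k => (le_abs_self _).trans (h k))
  have h2 := dotProduct_le_of_mem hξ (v := r - r')
    (fun k => (le_abs_self _).trans ((abs_sub_comm _ _).trans_le (h k)))
  simp only [dotProduct_sub, Matrix.mulVec_sub] at h1 h2 ⊢
  linarith

/-- An optimal solution of a linear program without binding constraints is supported on the
best actions of each class. -/
theorem eq_zero_or_isMax_of_isMaxOn {v ξ : Class n S × A → ℝ} (hξ : ξ ∈ symMechanisms n S A)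
    (hmax : IsMaxOn (fun ξ' => ξ' ⬝ᵥ v) (symMechanisms n S A) ξ) (c : Class n S) (a : A) :
    ξ (c, a) = 0 ∨ ∀ a', v (c, a') ≤ v (c, a) := by
  have : Nonempty A := ⟨a⟩
  -- Comparing ξ with the mechanism that plays a best action in each class shows that the
  -- nonnegative gaps sum to at most zero.
  choose m hm using fun c : Class n S => Finite.exists_max fun a => v (c, a)
  have hδ : (fun k : Class n S × A => if k.2 = m k.1 then (1 : ℝ) else 0) ∈
      symMechanisms n S A := by
    refine ⟨fun k => by dsimp only; split_ifs <;> norm_num, fun c => by simp⟩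
  have h1 : ∑ c, v (c, m c) ≤ ξ ⬝ᵥ v := by
    refine le_trans (le_of_eq ?_) (hmax hδ)
    simp [dotProduct, Fintype.sum_prod_type]
  have h2 : ∑ c, v (c, m c) - ξ ⬝ᵥ v = ∑ c, ∑ a, ξ (c, a) * (v (c, m c) - v (c, a)) := by
    simp only [dotProduct, Fintype.sum_prod_type, mul_sub, Finset.sum_sub_distrib,
      ← Finset.sum_mul, hξ.2, one_mul]
  have h3 : ∀ c a, 0 ≤ ξ (c, a) * (v (c, m c) - v (c, a)) := fun c a =>
    mul_nonneg (hξ.1 _) (sub_nonneg.2 (hm c a))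
  have h4 : ξ (c, a) * (v (c, m c) - v (c, a)) ≤ 0 := by
    calc _ ≤ ∑ a, ξ (c, a) * (v (c, m c) - v (c, a)) :=
          Finset.single_le_sum (fun a _ => h3 c a) (Finset.mem_univ a)
      _ ≤ ∑ c, ∑ a, ξ (c, a) * (v (c, m c) - v (c, a)) :=
          Finset.single_le_sum (f := fun c => ∑ a, ξ (c, a) * (v (c, m c) - v (c, a)))
            (fun c _ => Finset.sum_nonneg fun a _ => h3 c a) (Finset.mem_univ c)
      _ ≤ 0 := by rw [← h2]; linarith
  rcases mul_eq_zero.1 (le_antisymm h4 (h3 c a)) with h | h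
  · exact Or.inl h
  · exact Or.inr fun a' => (hm c a').trans (sub_eq_zero.1 h).le

variable [NeZero n] {Φ : Finset (S → S)} {b : ℝ} {rR rS rR' rS' η ξ ξOpt : Class n S × A → ℝ}

/-- The regret of an optimistic solution of the linear program, compared with a mechanism that
satisfies the exact constraints. -/
theorem IsLPSolution.regret_le (hR : ∀ k, |rR' k - rR k| ≤ η k) (hS : ∀ k, |rS' k - rS k| ≤ η k)
    (hη : ∀ k, η k ≤ b) (hS' : ∀ k, rS' k ∈ Set.Icc (0 : ℝ) 1)
    (hRmem : ∀ k, rR k ∈ Set.Icc (0 : ℝ) 1) (hOpt : ξOpt ∈ lpFeasible Φ 0 rS)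
    (hξ : IsLPSolution Φ (2 * Fintype.card (Class n S) * b) (rR' + η) rS' ξ) :
    ξOpt ⬝ᵥ rR - ξ ⬝ᵥ rR ≤ 2 * ξ ⬝ᵥ (fun k => min 1 (η k)) := by
  have hξ0 := hξ.1.1
  -- For b ≤ 1/2 the truncation is inactive and the usual optimism argument applies, with the
  -- benchmark feasible. For b > 1/2 the slack exceeds |𝒞|, which bounds every estimated gain from
  -- deviating, so the constraints disappear and the program decouples over the classes.
  rcases le_or_gt b (1 / 2) with hb | hb
  · have hfeas : ξOpt ∈ lpFeasible Φ (2 * Fintype.card (Class n S) * b) rS' := by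
      refine ⟨hOpt.1, fun φ hφ => ?_⟩
      have h1 := dotProduct_dev_le φ hOpt.1 (fun k => (hS k).trans (hη k))
      have h2 := hOpt.2 φ hφ
      linarith
    have h1 : ξOpt ⬝ᵥ (rR' + η) ≤ ξ ⬝ᵥ (rR' + η) := hξ.2 hfeas
    have h2 : ξOpt ⬝ᵥ rR ≤ ξOpt ⬝ᵥ (rR' + η) :=
      Finset.sum_le_sum fun k _ => mul_le_mul_of_nonneg_left
        (by have := abs_le.1 (hR k); simp only [Pi.add_apply]; linarith) (hOpt.1.1 k)
    have h3 : ξ ⬝ᵥ (rR' + η) ≤ ξ ⬝ᵥ rR + 2 * ξ ⬝ᵥ (fun k => min 1 (η k)) := by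
      simp only [dotProduct, Finset.mul_sum, ← Finset.sum_add_distrib]
      refine Finset.sum_le_sum fun k _ => ?_
      rw [min_eq_right ((hη k).trans (by linarith))]
      have h4 := mul_le_mul_of_nonneg_left
        (show rR' k + η k ≤ rR k + 2 * η k by have := abs_le.1 (hR k); linarith) (hξ0.1 k)
      simp only [Pi.add_apply]
      linarith
    linarith
  · have hall : ∀ ξ' ∈ symMechanisms n S A,
        ξ' ∈ lpFeasible Φ (2 * Fintype.card (Class n S) * b) rS' := by
      refine fun ξ' hξ' => ⟨hξ', fun φ _ => ?_⟩
      have h1 := dotProduct_devMatrix_mulVec_le φ hξ' (v := rS') (b := 1) (fun k => (hS' k).2)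
      have h2 : 0 ≤ ξ' ⬝ᵥ rS' := dotProduct_nonneg_of_nonneg hξ'.1 fun k => (hS' k).1
      have h3 : (Fintype.card (Class n S) : ℝ) * 1 ≤ Fintype.card (Class n S) * (2 * b) :=
        mul_le_mul_of_nonneg_left (by linarith) (Nat.cast_nonneg _)
      rw [dotProduct_sub]
      linarith
    have hmax : IsMaxOn (fun ξ' => ξ' ⬝ᵥ (rR' + η)) (symMechanisms n S A) ξ :=
      fun ξ' hξ' => hξ.2 (hall ξ' hξ')
    simp only [dotProduct, Fintype.sum_prod_type]
    rw [← Finset.sum_sub_distrib, Finset.mul_sum]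
    refine Finset.sum_le_sum (fun c _ => ?_)
    have key : ∀ a, ξ (c, a) * (∑ a', ξOpt (c, a') * rR (c, a') - rR (c, a)) ≤
        2 * (ξ (c, a) * min 1 (η (c, a))) := by
      intro a
      rcases eq_zero_or_isMax_of_isMaxOn hξ0 hmax c a with h | h
      · simp [h]
      · rw [mul_left_comm]
        refine mul_le_mul_of_nonneg_left ?_ (hξ0.1 _)
        -- At an action in the support, the gap is at most 1 because utilities lie in [0,1], and at
        -- most 2η because a has the largest upper confidence bound in its class. Both are needed
        -- for the bound 2 min(1, η).
        have hle : ∀ {B : ℝ}, (∀ a', rR (c, a') ≤ B) → ∑ a', ξOpt (c, a') * rR (c, a') ≤ B :=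
          fun {B} hB => by
          calc _ ≤ ∑ a', ξOpt (c, a') * B := Finset.sum_le_sum fun a' _ =>
                mul_le_mul_of_nonneg_left (hB a') (hOpt.1.1 _)
            _ = B := by rw [← Finset.sum_mul, hOpt.1.2, one_mul]
        have h1 := hle fun a' => (hRmem (c, a')).2
        have h2 := hle (B := rR' (c, a) + η (c, a)) fun a' => by
          have h3 := abs_le.1 (hR (c, a'))
          have h4 := h a'
          simp only [Pi.add_apply] at h4
          linarith
        have h5 := (hRmem (c, a)).1
        have h6 := abs_le.1 (hR (c, a))
        rcases min_choice 1 (η (c, a)) with h7 | h7 <;> rw [h7] <;> linarith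
    calc _ = ∑ a, ξ (c, a) * (∑ a', ξOpt (c, a') * rR (c, a') - rR (c, a)) := by
          simp only [mul_sub, Finset.sum_sub_distrib, ← Finset.sum_mul, hξ0.2, one_mul]
      _ ≤ ∑ a, 2 * (ξ (c, a) * min 1 (η (c, a))) := Finset.sum_le_sum fun a _ => key a
      _ = _ := by rw [Finset.mul_sum]

/-- The incentive violation of a solution of the linear program. -/
theorem IsLPSolution.violation_le (hS : ∀ k, |rS' k - rS k| ≤ b)
    (hξ : IsLPSolution Φ (2 * Fintype.card (Class n S) * b) rR' rS' ξ) {φ : S → S} (hφ : φ ∈ Φ) :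
    ξ ⬝ᵥ (devMatrix n A φ *ᵥ rS - rS) ≤ 4 * Fintype.card (Class n S) * b := by
  have h1 := dotProduct_dev_le φ hξ.1.1 (fun k => (abs_sub_comm _ _).trans_le (hS k))
  have h2 := hξ.1.2 φ hφ
  linarith

end LinearProgram
-- Counting along a single trajectory
section Trajectories

open Classical

/-- The number of indices below `t` at which `p` holds. -/
noncomputable def hits (p : ℕ → Prop) (t : ℕ) : ℕ := ∑ τ ∈ Finset.range t, if p τ then 1 else 0

theorem hits_succ (p : ℕ → Prop) (t : ℕ) : hits p (t + 1) = hits p t + if p t then 1 else 0 :=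
  Finset.sum_range_succ _ _

theorem hits_mono (p : ℕ → Prop) : Monotone (hits p) :=
  monotone_nat_of_le_succ fun t => by rw [hits_succ]; exact Nat.le_add_right _ _

theorem hits_le (p : ℕ → Prop) (t : ℕ) : hits p t ≤ t := by
  refine (Finset.sum_le_sum (g := fun _ => 1) fun τ _ => ?_).trans (by simp)
  split_ifs <;> simp

/-- If each `x τ` is a least chosen element so far, then all elements are chosen equally often. -/
theorem le_hits_of_argmin {A : Type*} [Fintype A] (x : ℕ → A) (E : ℕ)
    (h : ∀ τ < Fintype.card A * E, ∀ a, hits (x · = x τ) τ ≤ hits (x · = a) τ) (a : A) :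
    E ≤ hits (x · = a) (Fintype.card A * E) := by
  -- Invariant: choosing a least used element keeps all counts within 1 of each other. One count
  -- below E would then force all to be at most E, contradicting the total |𝒜|E.
  have hdiff : ∀ t ≤ Fintype.card A * E, ∀ a a', hits (x · = a) t ≤ hits (x · = a') t + 1 := by
    intro t
    induction t with
    | zero => intro _ a a'; simp [hits]
    | succ t ih =>
      intro ht a a'
      rw [hits_succ, hits_succ]
      have h1 := ih (by omega) a a'
      by_cases ha : x t = a
      · have := h t (by omega) a'
        subst ha
        simp only [if_true]
        omega
      · simp only [ha, if_false]
        omega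
  have hsum : ∀ t, ∑ a, hits (x · = a) t = t := fun t => by
    unfold hits
    rw [Finset.sum_comm]
    simp
  by_contra! hlt
  have hle : ∀ a', hits (x · = a') (Fintype.card A * E) ≤ E := fun a' => by
    have := hdiff _ le_rfl a' a
    omega
  have := Finset.sum_lt_sum (fun a' _ => hle a') ⟨a, Finset.mem_univ a, hlt⟩
  rw [hsum] at this
  simp at this

/-- The terms telescope against 4√N, because 1/√N ≤ 4(√(N+1) - √N) for N ≥ 1. The first hit has N =
0, where Lean's 1/√0 is 0. -/
theorem sum_inv_sqrt_hits_le (p : ℕ → Prop) (T : ℕ) :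
    ∑ t ∈ Finset.range T, (if p t then 1 / √(hits p t : ℝ) else 0) ≤ 4 * √(hits p T : ℝ) := by
  induction T with
  | zero => simp [hits]
  | succ T ih =>
    rw [Finset.sum_range_succ, hits_succ]
    split_ifs with hp
    · rcases Nat.eq_zero_or_pos (hits p T) with h0 | h0
      · rw [h0] at ih ⊢
        simp at ih ⊢
        linarith
      · have hN : (1 : ℝ) ≤ hits p T := by exact_mod_cast h0
        push_cast
        generalize (hits p T : ℝ) = N at *
        have hs : 1 ≤ √N := Real.one_le_sqrt.2 hN
        have hs1 : √(N + 1) ≤ 2 * √N := by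
          rw [show 2 * √N = √(4 * N) by
            rw [Real.sqrt_mul (by norm_num), show (4 : ℝ) = 2 ^ 2 by norm_num,
              Real.sqrt_sq (by norm_num)]]
          exact Real.sqrt_le_sqrt (by linarith)
        have e1 := Real.sq_sqrt (show 0 ≤ N by linarith)
        have e2 := Real.sq_sqrt (show 0 ≤ N + 1 by linarith)
        have h2 : √N ≤ √(N + 1) := Real.sqrt_le_sqrt (by linarith)
        have : 1 / √N ≤ 4 * (√(N + 1) - √N) := by
          rw [div_le_iff₀ (by linarith)]
          nlinarith
        linarith
    · simpa using ih

variable {n : ℕ} {Θ S A : Type*} [Fintype Θ] [Fintype S] [Fintype A]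

theorem Game.count_feedback (G : Game Θ S A) (g : ℕ → Round n Θ S A) (t : ℕ) (c : Class n S)
    (a : A) : count (fun i : Fin t => G.feedback (g i)) c a = hits (fun τ => (g τ).2.2 c = a) t :=
  Fin.sum_univ_eq_sum_range (fun τ => if (g τ).2.2 c = a then 1 else 0) t

/-- The estimate of `u` after `t` rounds. -/
theorem estimate_feedback (G : Game Θ S A) (g : ℕ → Round n Θ S A) (u : A → Θ → ℝ) (t : ℕ)
    (c : Class n S) (a : A) :
    estimate (fun i : Fin t => G.feedback (g i))
      (fun i => u ((g i).2.2 (classOf (g i).2.1)) (g i).1) (c, a) =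
    (∑ τ ∈ Finset.range t, if (g τ).2.2 c = a then u ((g τ).2.2 (classOf (g τ).2.1)) (g τ).1 *
      (if classOf (g τ).2.1 = c then 1 else 0) else 0) /
      (hits (fun τ => (g τ).2.2 c = a) t : ℝ) := by
  unfold estimate
  rw [G.count_feedback]
  congr 1
  exact Fin.sum_univ_eq_sum_range (fun τ => if (g τ).2.2 c = a then
    u ((g τ).2.2 (classOf (g τ).2.1)) (g τ).1 *
      (if classOf (g τ).2.1 = c then 1 else 0) else 0) t

theorem estimate_feedback_mem (G : Game Θ S A) (g : ℕ → Round n Θ S A) (u : A → Θ → ℝ)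
    (hu : ∀ a θ, u a θ ∈ Set.Icc (0 : ℝ) 1) (t : ℕ) (k : Class n S × A) :
    estimate (fun i : Fin t => G.feedback (g i))
      (fun i => u ((g i).2.2 (classOf (g i).2.1)) (g i).1) k ∈ Set.Icc (0 : ℝ) 1 := by
  obtain ⟨c, a⟩ := k
  have h1 : ∀ τ, (u ((g τ).2.2 (classOf (g τ).2.1)) (g τ).1 *
      (if classOf (g τ).2.1 = c then 1 else 0)) ∈ Set.Icc (0 : ℝ) 1 := fun τ => by
    have := hu ((g τ).2.2 (classOf (g τ).2.1)) (g τ).1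
    split_ifs <;> simp_all
  rw [estimate_feedback]
  refine ⟨div_nonneg (Finset.sum_nonneg fun τ _ => ?_) (Nat.cast_nonneg _),
    div_le_one_of_le₀ ?_ (Nat.cast_nonneg _)⟩
  · by_cases h : (g τ).2.2 c = a
    · simpa only [h, if_true] using (h1 τ).1
    · simp [h]
  · unfold hits
    push_cast
    refine Finset.sum_le_sum fun τ _ => ?_
    by_cases h : (g τ).2.2 c = a
    · simpa only [h, if_true] using (h1 τ).2
    · simp [h]

/-- The value along a trajectory of the exponent that controls the first `m` observations of
the utility of `a` at `c`. -/
theorem sum_exponent_eq (p : ℕ → Prop) (X : ℕ → ℝ) (r l : ℝ) {t T : ℕ} (ht : t ≤ T) :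
    (∑ τ ∈ Finset.range T, if p τ ∧ hits p τ < hits p t then l * (X τ - r) - l ^ 2 / 8 else 0) =
      l * ((∑ τ ∈ Finset.range t, if p τ then X τ else 0) - hits p t * r) -
        hits p t * (l ^ 2 / 8) := by
  -- A hit at τ is among the first `hits p t` hits exactly when τ < t, so the process frozen at that
  -- count sums the hits before t.
  have h1 : (∑ τ ∈ Finset.range T,
      if p τ ∧ hits p τ < hits p t then l * (X τ - r) - l ^ 2 / 8 else 0) =
      ∑ τ ∈ Finset.range t, if p τ then l * (X τ - r) - l ^ 2 / 8 else 0 := by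
    symm
    rw [← Finset.sum_subset (Finset.range_subset_range.2 ht)]
    · refine Finset.sum_congr rfl fun τ hτ => ?_
      by_cases hp : p τ
      · have h2 := hits_mono p (Finset.mem_range.1 hτ : τ + 1 ≤ t)
        rw [hits_succ, if_pos hp] at h2
        simp only [hp, true_and]
        rw [if_pos trivial, if_pos (by omega)]
      · simp [hp]
    · intro τ _ hτ
      have h2 := hits_mono p (not_lt.1 (mt Finset.mem_range.2 hτ))
      exact if_neg fun h => absurd h.2 (not_lt.2 h2)
  have h2 : (hits p t : ℝ) = ∑ τ ∈ Finset.range t, if p τ then 1 else 0 := by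
    unfold hits; push_cast; rfl
  rw [h1, h2, Finset.sum_mul, Finset.sum_mul, ← Finset.sum_sub_distrib, Finset.mul_sum,
    ← Finset.sum_sub_distrib]
  refine Finset.sum_congr rfl fun τ _ => ?_
  split_ifs <;> ring

/-- With η the width, mη² = L/2. The choice l = ±4η makes the variance term ml²/8 equal to L, and a
deviation beyond η would make the linear term exceed 2L. -/
theorem abs_sub_le_of_exponent_lt {m L x r : ℝ} (hm : 0 < m) (hL : 0 < L)
    (h1 : 4 * √(L / (2 * m)) * (x - m * r) - m * ((4 * √(L / (2 * m))) ^ 2 / 8) < L)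
    (h2 : -(4 * √(L / (2 * m))) * (x - m * r) - m * ((-(4 * √(L / (2 * m)))) ^ 2 / 8) < L) :
    |x / m - r| ≤ √(L / (2 * m)) := by
  have hη : 0 < √(L / (2 * m)) := Real.sqrt_pos.2 (by positivity)
  have hsq : m * √(L / (2 * m)) ^ 2 = L / 2 := by
    rw [Real.sq_sqrt (by positivity)]; field_simp
  generalize √(L / (2 * m)) = η at *
  have e : x - m * r = m * (x / m - r) := by field_simp
  rw [e] at h1 h2
  generalize x / m - r = d at *
  have hmη : 0 < m * η := by positivity
  rw [abs_le]
  constructor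
  · by_contra! hd
    nlinarith
  · by_contra! hd
    nlinarith

end Trajectories
-- Deterministic guarantees on the good event
section Trajectory

open scoped Matrix
open Classical

variable {n : ℕ} [NeZero n] {Θ S A : Type*} [Fintype Θ] [Fintype S] [Fintype A]

/-- The mechanism selected after `t` rounds along the trajectory `g`. -/
noncomputable def Game.selectAt (G : Game Θ S A) (alg : Algorithm n S A) (g : ℕ → Round n Θ S A)
    (t : ℕ) : symMechanisms n S A :=
  G.select alg fun i : Fin t => g i

/-- The confidence width after `t` rounds along the trajectory `g`, truncated at `1`. -/
noncomputable def Game.weightAt (G : Game Θ S A) (T : ℕ) (δ : ℝ) (g : ℕ → Round n Θ S A)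
    (t : ℕ) : Class n S × A → ℝ :=
  fun k => min 1 (width T δ (fun i : Fin t => G.feedback (g i)) k)

/-- The estimates of the utility `u` are within the confidence widths along `g`. -/
def Game.Accurate (G : Game Θ S A) (T : ℕ) (δ : ℝ) (g : ℕ → Round n Θ S A) (u : A → Θ → ℝ) :
    Prop :=
  ∀ t < T, ∀ c a, 0 < hits (fun τ => (g τ).2.2 c = a) t →
    |estimate (fun i : Fin t => G.feedback (g i))
      (fun i => u ((g i).2.2 (classOf (g i).2.1)) (g i).1) (c, a) - G.utilityVec n u (c, a)| ≤
      width T δ (fun i : Fin t => G.feedback (g i)) (c, a)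

variable {G : Game Θ S A} {Φ : Finset (S → S)} {alg : Algorithm n S A} {T E : ℕ} {δ : ℝ}
  {g : ℕ → Round n Θ S A}

theorem Game.weightAt_mem (k : Class n S × A) (t : ℕ) :
    G.weightAt T δ g t k ∈ Set.Icc (0 : ℝ) 1 :=
  ⟨le_min zero_le_one (Real.sqrt_nonneg _), min_le_left _ _⟩

/-- After the exploration, each action was used at least `E` times for every class. -/
theorem IsExploreThenUCB.le_hits (halg : IsExploreThenUCB Φ T E δ alg)
    (hg : ∀ t < T, ∀ c, (G.selectAt alg g t).1 (c, (g t).2.2 c) ≠ 0) {t : ℕ} (htT : t < T)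
    (ht : Fintype.card A * E ≤ t) (c : Class n S) (a : A) :
    E ≤ hits (fun τ => (g τ).2.2 c = a) t := by
  have hconst : ∀ τ < Fintype.card A * E, (∀ c', (g τ).2.2 c' = (g τ).2.2 c) ∧
      ∀ a', ∑ c', hits (fun i => (g i).2.2 c' = (g τ).2.2 c) τ ≤
        ∑ c', hits (fun i => (g i).2.2 c' = a') τ := by
    intro τ hτ
    obtain ⟨a₀, h1, h2⟩ := (halg τ (by omega) fun i : Fin τ => G.feedback (g i)).1 hτ
    -- The sampled action has positive probability under the selected mechanism, which is
    -- concentrated on a₀.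
    have h3 : ∀ c', (g τ).2.2 c' = a₀ := fun c' => by
      by_contra hne
      exact hg τ (by omega) c' ((h2 c' _).trans (if_neg hne))
    refine ⟨fun c' => (h3 c').trans (h3 c).symm, fun a' => ?_⟩
    have h4 := h1 a'
    simp only [G.count_feedback] at h4
    rw [h3 c]
    exact h4
  -- Exploration plays one action for all classes at once, so the counts do not depend on the class,
  -- and minimizing their sum over c minimizes each of them.
  have hhits : ∀ τ ≤ Fintype.card A * E, ∀ c' a',
      hits (fun τ => (g τ).2.2 c' = a') τ = hits (fun τ => (g τ).2.2 c = a') τ := by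
    intro τ hτ c' a'
    refine Finset.sum_congr rfl fun i hi => ?_
    simp only [(hconst i ((Finset.mem_range.1 hi).trans_le hτ)).1 c']
  refine le_trans (le_hits_of_argmin (fun τ => (g τ).2.2 c) E (fun τ hτ a' => ?_) a)
    (hits_mono _ ht)
  have h := (hconst τ hτ).2 a'
  simp only [hhits τ hτ.le, Finset.sum_const, smul_eq_mul] at h
  exact Nat.le_of_mul_le_mul_left h (Finset.card_pos.2 ⟨c, Finset.mem_univ c⟩)

/-- The regret of a single round. -/
theorem IsExploreThenUCB.round_regret_le (halg : IsExploreThenUCB Φ T E δ alg) (hE : 1 ≤ E)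
    (hL : 0 ≤ logTerm n S A T δ)
    (hg : ∀ t < T, ∀ c, (G.selectAt alg g t).1 (c, (g t).2.2 c) ≠ 0)
    (hR : G.Accurate T δ g G.uR) (hS : G.Accurate T δ g G.uS)
    {ξOpt : Class n S × A → ℝ} (hOpt : ξOpt ∈ lpFeasible Φ 0 (G.utilityVec n G.uS))
    {t : ℕ} (ht : t < T) :
    ξOpt ⬝ᵥ G.utilityVec n G.uR - (G.selectAt alg g t).1 ⬝ᵥ G.utilityVec n G.uR ≤
      (if t < Fintype.card A * E then 1 else 0) +
        2 * (G.selectAt alg g t).1 ⬝ᵥ G.weightAt T δ g t ∧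
    ∀ φ ∈ Φ, (G.selectAt alg g t).1 ⬝ᵥ
      (devMatrix n A φ *ᵥ G.utilityVec n G.uS - G.utilityVec n G.uS) ≤
        4 * Fintype.card (Class n S) * √(logTerm n S A T δ / (2 * E)) := by
  have hw : 0 ≤ (G.selectAt alg g t).1 ⬝ᵥ G.weightAt T δ g t :=
    dotProduct_nonneg_of_nonneg (G.selectAt alg g t).2.1 fun k => (Game.weightAt_mem k t).1
  by_cases htE : t < Fintype.card A * E
  · rw [if_pos htE]
    constructor
    · have h1 := (G.dotProduct_utilityVec_mem G.uR G.uR_mem hOpt.1).2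
      have h2 := (G.dotProduct_utilityVec_mem G.uR G.uR_mem (G.selectAt alg g t).2).1
      linarith
    · intro φ _
      obtain ⟨a, -, ha⟩ := (halg t ht fun i : Fin t => G.feedback (g i)).1 htE
      refine (G.violation_const φ (a := a) ha).trans_le ?_
      positivity
  · rw [if_neg htE, zero_add]
    have hcount : ∀ c a, E ≤ hits (fun τ => (g τ).2.2 c = a) t :=
      halg.le_hits hg ht (not_lt.1 htE)
    have hη : ∀ k, width T δ (fun i : Fin t => G.feedback (g i)) k ≤
        √(logTerm n S A T δ / (2 * E)) := by
      rintro ⟨c, a⟩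
      refine Real.sqrt_le_sqrt ?_
      rw [G.count_feedback]
      have h1 : (1 : ℝ) ≤ E := by exact_mod_cast hE
      have h2 : (E : ℝ) ≤ hits (fun τ => (g τ).2.2 c = a) t := by exact_mod_cast hcount c a
      gcongr
    have hsol := (halg t ht fun i : Fin t => G.feedback (g i)).2 (not_lt.1 htE)
    have hR' := fun k : Class n S × A => hR t ht k.1 k.2 (hE.trans (hcount k.1 k.2))
    have hS' := fun k : Class n S × A => hS t ht k.1 k.2 (hE.trans (hcount k.1 k.2))
    exact ⟨hsol.regret_le hR' hS' hη (estimate_feedback_mem G g G.uS G.uS_mem t)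
      (fun k => ⟨G.utilityVec_nonneg _ G.uR_mem k, G.utilityVec_le_one _ G.uR_mem k⟩) hOpt,
      fun φ hφ => hsol.violation_le (fun k => (hS' k).trans (hη k)) hφ⟩

/-- The widths of the pairs of classes and actions used along a trajectory add up to `O(√T)`. -/
theorem Game.sum_weightAt_le (G : Game Θ S A) (g : ℕ → Round n Θ S A) (T : ℕ) (δ : ℝ)
    (hL : 0 ≤ logTerm n S A T δ) :
    ∑ t ∈ Finset.range T, ∑ c, G.weightAt T δ g t (c, (g t).2.2 c) ≤
      4 * (Fintype.card (Class n S) * Fintype.card A * √(T * logTerm n S A T δ / 2)) := by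
  have h1 : ∀ t c, G.weightAt T δ g t (c, (g t).2.2 c) ≤
      ∑ a, if (g t).2.2 c = a then
        √(logTerm n S A T δ / 2) * (1 / √(hits (fun τ => (g τ).2.2 c = a) t : ℝ)) else 0 := by
    intro t c
    rw [Finset.sum_ite_eq, if_pos (Finset.mem_univ _)]
    refine (min_le_right _ _).trans (le_of_eq ?_)
    unfold width
    rw [G.count_feedback, ← div_div, Real.sqrt_div (by positivity), mul_one_div]
  calc _ ≤ ∑ t ∈ Finset.range T, ∑ c, ∑ a, if (g t).2.2 c = a then
        √(logTerm n S A T δ / 2) * (1 / √(hits (fun τ => (g τ).2.2 c = a) t : ℝ)) else 0 :=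
        Finset.sum_le_sum fun t _ => Finset.sum_le_sum fun c _ => h1 t c
    _ = ∑ c : Class n S, ∑ a : A, √(logTerm n S A T δ / 2) * ∑ t ∈ Finset.range T,
          if (g t).2.2 c = a then 1 / √(hits (fun τ => (g τ).2.2 c = a) t : ℝ) else 0 := by
        rw [Finset.sum_comm]
        refine Finset.sum_congr rfl fun c _ => ?_
        rw [Finset.sum_comm]
        refine Finset.sum_congr rfl fun a _ => ?_
        rw [Finset.mul_sum]
        exact Finset.sum_congr rfl fun t _ => by rw [mul_ite, mul_zero]
    _ ≤ ∑ c : Class n S, ∑ a : A, √(logTerm n S A T δ / 2) * (4 * √(T : ℝ)) := by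
        refine Finset.sum_le_sum fun c _ => Finset.sum_le_sum fun a _ => ?_
        refine mul_le_mul_of_nonneg_left ((sum_inv_sqrt_hits_le _ T).trans ?_) (Real.sqrt_nonneg _)
        gcongr
        exact hits_le _ T
    _ = _ := by
        rw [mul_div_assoc, Real.sqrt_mul (Nat.cast_nonneg T)]
        simp only [Finset.sum_const, Finset.card_univ, nsmul_eq_mul]
        ring

/-- The guarantees along a trajectory on which the estimates are accurate. -/
theorem IsExploreThenUCB.regret_violation_le (halg : IsExploreThenUCB Φ T E δ alg) (hE : 1 ≤ E)
    (hL : 0 ≤ logTerm n S A T δ) (hΦ : Φ.Nonempty)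
    (hg : ∀ t < T, ∀ c, (G.selectAt alg g t).1 (c, (g t).2.2 c) ≠ 0)
    (hR : G.Accurate T δ g G.uR) (hS : G.Accurate T δ g G.uS)
    (hsamp : ∑ t ∈ Finset.range T, ((G.selectAt alg g t).1 ⬝ᵥ G.weightAt T δ g t -
      ∑ c, G.weightAt T δ g t (c, (g t).2.2 c)) ≤
        Fintype.card (Class n S) * √(T * logTerm n S A T δ / 2))
    {x : (Fin n → S) × A → ℝ} (hx : G.IsOptimalIC Φ x) [Nonempty A] :
    G.regret alg x (fun i : Fin T => g i) ≤ 10 * (Fintype.card A * E +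
      Fintype.card (Class n S) * Fintype.card A * √(T * logTerm n S A T δ)) ∧
    G.violation Φ hΦ alg (fun i : Fin T => g i) ≤
      10 * (T * Fintype.card (Class n S) * √(logTerm n S A T δ / E)) := by
  obtain ⟨hOpt, hval⟩ := G.symmetrize_mem_lpFeasible Φ hx.1
  have hround := fun {t : ℕ} (ht : t < T) => halg.round_regret_le hE hL hg hR hS hOpt ht
  constructor
  · have hA : (1 : ℝ) ≤ Fintype.card A := by exact_mod_cast Fintype.card_pos (α := A)
    have h1 : G.regret alg x (fun i : Fin T => g i) = ∑ t ∈ Finset.range T,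
        (symmetrize x ⬝ᵥ G.utilityVec n G.uR -
          (G.selectAt alg g t).1 ⬝ᵥ G.utilityVec n G.uR) := by
      rw [hval]
      exact Fin.sum_univ_eq_sum_range (fun t => G.utility G.uR x -
        (G.selectAt alg g t).1 ⬝ᵥ G.utilityVec n G.uR) T
    have h2 : ∑ t ∈ Finset.range T, (if t < Fintype.card A * E then (1 : ℝ) else 0) ≤
        Fintype.card A * E := by
      rw [← Finset.sum_filter, Finset.sum_const, nsmul_eq_mul, mul_one]
      have : ((Finset.range T).filter (· < Fintype.card A * E)).card ≤ Fintype.card A * E := by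
        refine (Finset.card_le_card (t := Finset.range (Fintype.card A * E)) fun t ht => ?_).trans
          (by simp)
        exact Finset.mem_range.2 (Finset.mem_filter.1 ht).2
      exact_mod_cast this
    have h3 := Finset.sum_le_sum fun t ht => (hround (Finset.mem_range.1 ht)).1
    have h4 := G.sum_weightAt_le g T δ hL
    rw [Finset.sum_add_distrib, ← Finset.mul_sum] at h3
    rw [Finset.sum_sub_distrib] at hsamp
    have h5 : √(T * logTerm n S A T δ / 2) ≤ √(T * logTerm n S A T δ) := by
      refine Real.sqrt_le_sqrt (half_le_self ?_)
      positivity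
    have h6 : (Fintype.card (Class n S) : ℝ) * √(T * logTerm n S A T δ / 2) ≤
        Fintype.card (Class n S) * Fintype.card A * √(T * logTerm n S A T δ / 2) := by
      refine mul_le_mul_of_nonneg_right ?_ (Real.sqrt_nonneg _)
      exact le_mul_of_one_le_right (Nat.cast_nonneg _) hA
    have h7 : (Fintype.card (Class n S) : ℝ) * Fintype.card A * √(T * logTerm n S A T δ / 2) ≤
        Fintype.card (Class n S) * Fintype.card A * √(T * logTerm n S A T δ) :=
      mul_le_mul_of_nonneg_left h5 (by positivity)
    have h8 : (0 : ℝ) ≤ Fintype.card A * E := by positivity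
    rw [h1]
    -- The constant is 10 = 2(4 + 1): 4 from the sum of the sampled widths, 1 from the sampling
    -- deviation, and 2 from optimism.
    linarith
  · have h1 : G.violation Φ hΦ alg (fun i : Fin T => g i) ≤ ∑ _t : Fin T,
        4 * Fintype.card (Class n S) * √(logTerm n S A T δ / (2 * E)) :=
      Finset.sum_le_sum fun t _ => Finset.sup'_le _ _ fun φ hφ => (hround t.2).2 φ hφ
    rw [Finset.sum_const, Finset.card_univ, Fintype.card_fin, nsmul_eq_mul] at h1
    have h2 : √(logTerm n S A T δ / (2 * E)) ≤ √(logTerm n S A T δ / E) := by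
      refine Real.sqrt_le_sqrt ?_
      have : (1 : ℝ) ≤ E := by exact_mod_cast hE
      gcongr
      linarith
    have h3 : (T : ℝ) * (Fintype.card (Class n S) * √(logTerm n S A T δ / (2 * E))) ≤
        T * (Fintype.card (Class n S) * √(logTerm n S A T δ / E)) := by gcongr
    have h4 : 0 ≤ (T : ℝ) * (Fintype.card (Class n S) * √(logTerm n S A T δ / E)) := by positivity
    linarith

end Trajectory

/-! ### Union bound and the guarantee for fixed E -/

section HighProbability

open scoped Matrix ENNReal
open Classical

variable {n : ℕ} [NeZero n] {Θ S A : Type*} [Fintype Θ] [Fintype S] [Fintype A]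

theorem one_le_logTerm [Nonempty (Class n S)] [Nonempty A] {T : ℕ} (hT : 1 ≤ T) {δ : ℝ}
    (hδ : δ ∈ Set.Ioo (0 : ℝ) 1) : 1 ≤ logTerm n S A T δ := by
  have h1 : (1 : ℝ) ≤ T := by exact_mod_cast hT
  have h2 : (1 : ℝ) ≤ Fintype.card (Class n S) := by exact_mod_cast Fintype.card_pos
  have h3 : (1 : ℝ) ≤ Fintype.card A := by exact_mod_cast Fintype.card_pos
  have h4 : (8 : ℝ) ≤ 8 * T * Fintype.card (Class n S) * Fintype.card A / δ := by
    rw [le_div_iff₀ hδ.1]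
    have := one_le_mul_of_one_le_of_one_le (one_le_mul_of_one_le_of_one_le h1 h2) h3
    nlinarith [hδ.2]
  rw [logTerm, Real.le_log_iff_exp_le (by linarith)]
  linarith [Real.exp_one_lt_d9]

/-- The exponent that controls the first `m` observations of `u a` at the class `c`. -/
noncomputable def Game.estimateExponent (G : Game Θ S A) (u : A → Θ → ℝ) (c : Class n S) (a : A)
    (m : ℕ) (l : ℝ) (t : ℕ) (h : Fin t → Round n Θ S A) (ω : Round n Θ S A) : ℝ :=
  if ω.2.2 c = a ∧ count (fun i => G.feedback (h i)) c a < m then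
    l * (u (ω.2.2 (classOf ω.2.1)) ω.1 * (if classOf ω.2.1 = c then 1 else 0) -
      G.utilityVec n u (c, a)) - l ^ 2 / 8 else 0

/-- The exponent that controls the deviations of the sampled mechanisms. -/
noncomputable def Game.sampleExponent (G : Game Θ S A) (alg : Algorithm n S A) (T : ℕ) (δ l : ℝ)
    (t : ℕ) (h : Fin t → Round n Θ S A) (ω : Round n Θ S A) : ℝ :=
  l * ((G.select alg h).1 ⬝ᵥ (fun k => min 1 (width T δ (fun i => G.feedback (h i)) k)) -
    ∑ c, min 1 (width T δ (fun i => G.feedback (h i)) (c, ω.2.2 c))) -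
      l ^ 2 * (Fintype.card (Class n S) : ℝ) ^ 2 / 8

/-- The trajectories along which the sum of the exponents is at least `L`. -/
def exceed (L : ℝ) (D : (t : ℕ) → (Fin t → Round n Θ S A) → Round n Θ S A → ℝ) (T : ℕ) :
    Set (Fin T → Round n Θ S A) :=
  {h | L ≤ ∑ t : Fin T, D t (fun i : Fin t => h (i.castLE t.2.le)) (h t)}

theorem Game.measure_exceed_estimate (G : Game Θ S A) (alg : Algorithm n S A) (u : A → Θ → ℝ)
    (hu : ∀ a θ, u a θ ∈ Set.Icc (0 : ℝ) 1) (c : Class n S) (a : A) (m : ℕ) (l L : ℝ) (T : ℕ) :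
    (G.run alg T).toOuterMeasure (exceed L (G.estimateExponent u c a m l) T) ≤
      ENNReal.ofReal (Real.exp (-L)) :=
  toOuterMeasure_le_of_tsum_exp _ (fun h : Fin T → Round n Θ S A => ∑ t : Fin T,
    G.estimateExponent u c a m l t (fun i : Fin t => h (i.castLE t.2.le)) (h t)) _
    (G.tsum_run_exp alg (G.estimateExponent u c a m l) (fun t h => by
      unfold Game.estimateExponent
      exact G.tsum_roundLaw_exp_estimate _ u hu c a _ l) T)

theorem Game.measure_exceed_sample (G : Game Θ S A) (alg : Algorithm n S A) (δ l L : ℝ) (T : ℕ) :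
    (G.run alg T).toOuterMeasure (exceed L (G.sampleExponent alg T δ l) T) ≤
      ENNReal.ofReal (Real.exp (-L)) :=
  toOuterMeasure_le_of_tsum_exp _ (fun h : Fin T → Round n Θ S A => ∑ t : Fin T,
    G.sampleExponent alg T δ l t (fun i : Fin t => h (i.castLE t.2.le)) (h t)) _
    (G.tsum_run_exp alg (G.sampleExponent alg T δ l) (fun t h => by
      unfold Game.sampleExponent
      exact G.tsum_roundLaw_exp_sample _
        (fun k => min 1 (width T δ (fun i => G.feedback (h i)) k))
        (fun _ => ⟨le_min zero_le_one (Real.sqrt_nonneg _), min_le_left _ _⟩) l) T)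

theorem Game.accurate_of_notMem_exceed (G : Game Θ S A) (u : A → Θ → ℝ) (T : ℕ) (δ : ℝ)
    (hL : 0 < logTerm n S A T δ) (g : ℕ → Round n Θ S A)
    (h : ∀ (c : Class n S) (a : A), ∀ m ∈ Finset.range T, ∀ b : Bool,
      (fun i : Fin T => g i) ∉ exceed (logTerm n S A T δ) (G.estimateExponent u c a m
        (if b then 4 * √(logTerm n S A T δ / (2 * m)) else
          -(4 * √(logTerm n S A T δ / (2 * m))))) T) :
    G.Accurate T δ g u := by
  intro t ht c a hpos
  set p : ℕ → Prop := fun τ => (g τ).2.2 c = a with hp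
  have hsum : ∀ l : ℝ, ∑ i : Fin T, G.estimateExponent u c a (hits p t) l i
      (fun j : Fin i => g j) (g i) =
      l * ((∑ τ ∈ Finset.range t, if p τ then u ((g τ).2.2 (classOf (g τ).2.1)) (g τ).1 *
        (if classOf (g τ).2.1 = c then 1 else 0) else 0) -
          hits p t * G.utilityVec n u (c, a)) - hits p t * (l ^ 2 / 8) := by
    intro l
    rw [← sum_exponent_eq p _ _ l ht.le, ← Fin.sum_univ_eq_sum_range]
    refine Finset.sum_congr rfl fun i _ => ?_
    unfold Game.estimateExponent
    rw [G.count_feedback]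
  -- The random count is at most t < T, so it is one of the fixed values of m excluded by
  -- hypothesis.
  have hm : hits p t ∈ Finset.range T := Finset.mem_range.2 ((hits_le p t).trans_lt ht)
  have h1 := h c a _ hm true
  have h2 := h c a _ hm false
  simp only [exceed, Set.mem_ofPred_eq, not_le, Fin.val_castLE, hsum, if_true,
    Bool.false_eq_true, if_false] at h1 h2
  rw [estimate_feedback, width, G.count_feedback]
  exact abs_sub_le_of_exponent_lt (by exact_mod_cast hpos) hL h1 h2

/-- With y = √(TL/2), the choice l = 4y/(T|𝒞|) makes the total variance term equal to L, while a
deviation of |𝒞|y would contribute 2L to the linear term. -/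
theorem Game.sample_le_of_notMem_exceed [Nonempty (Class n S)] (G : Game Θ S A)
    (alg : Algorithm n S A) {T : ℕ} (hT : 1 ≤ T) (δ : ℝ) (hL : 0 < logTerm n S A T δ)
    (g : ℕ → Round n Θ S A)
    (h : (fun i : Fin T => g i) ∉ exceed (logTerm n S A T δ) (G.sampleExponent alg T δ
      (4 * √(T * logTerm n S A T δ / 2) / (T * Fintype.card (Class n S)))) T) :
    ∑ t ∈ Finset.range T, ((G.selectAt alg g t).1 ⬝ᵥ G.weightAt T δ g t -
      ∑ c, G.weightAt T δ g t (c, (g t).2.2 c)) ≤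
        Fintype.card (Class n S) * √(T * logTerm n S A T δ / 2) := by
  have hTpos : (0 : ℝ) < T := by exact_mod_cast hT
  have hC : (0 : ℝ) < Fintype.card (Class n S) := by exact_mod_cast Fintype.card_pos
  have hsum : ∀ l : ℝ, ∑ i : Fin T, G.sampleExponent alg T δ l i (fun j : Fin i => g j) (g i) =
      l * (∑ t ∈ Finset.range T, ((G.selectAt alg g t).1 ⬝ᵥ G.weightAt T δ g t -
        ∑ c, G.weightAt T δ g t (c, (g t).2.2 c))) -
        T * (l ^ 2 * (Fintype.card (Class n S) : ℝ) ^ 2 / 8) := by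
    intro l
    rw [← Fin.sum_univ_eq_sum_range (fun t => ((G.selectAt alg g t).1 ⬝ᵥ G.weightAt T δ g t -
        ∑ c, G.weightAt T δ g t (c, (g t).2.2 c))), Finset.mul_sum]
    have : (T : ℝ) * (l ^ 2 * (Fintype.card (Class n S) : ℝ) ^ 2 / 8) =
        ∑ _i : Fin T, l ^ 2 * (Fintype.card (Class n S) : ℝ) ^ 2 / 8 := by simp
    rw [this, ← Finset.sum_sub_distrib]
    rfl
  simp only [exceed, Set.mem_ofPred_eq, not_le, Fin.val_castLE, hsum] at h
  generalize (∑ t ∈ Finset.range T, ((G.selectAt alg g t).1 ⬝ᵥ G.weightAt T δ g t -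
      ∑ c, G.weightAt T δ g t (c, (g t).2.2 c))) = s at *
  have hsq : √(T * logTerm n S A T δ / 2) ^ 2 = T * logTerm n S A T δ / 2 :=
    Real.sq_sqrt (by positivity)
  have hypos : 0 < √(T * logTerm n S A T δ / 2) := Real.sqrt_pos.2 (by positivity)
  generalize √(T * logTerm n S A T δ / 2) = y at *
  generalize (Fintype.card (Class n S) : ℝ) = C at *
  generalize logTerm n S A T δ = L at *
  generalize (T : ℝ) = N at *
  have e1 : N * ((4 * y / (N * C)) ^ 2 * C ^ 2 / 8) = L := by
    field_simp
    rw [hsq]; ring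
  rw [e1] at h
  have h2 : 4 * y / (N * C) * s < 4 * y / (N * C) * (C * y) := by
    have : 4 * y / (N * C) * (C * y) = 2 * L := by
      field_simp
      rw [hsq]; ring
    linarith
  exact (lt_of_mul_lt_mul_left h2 (by positivity)).le

/-- The guarantees of the explore-then-UCB algorithm, with an explicit constant. -/
theorem Game.run_regret_violation (G : Game Θ S A) {Φ : Finset (S → S)} (hΦ : Φ.Nonempty)
    {x : (Fin n → S) × A → ℝ} (hx : G.IsOptimalIC Φ x) {T E : ℕ} (hE : 1 ≤ E) (hT : 1 ≤ T)
    {δ : ℝ} (hδ : δ ∈ Set.Ioo (0 : ℝ) 1) {alg : Algorithm n S A}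
    (halg : IsExploreThenUCB Φ T E δ alg) :
    ENNReal.ofReal (1 - δ) ≤ (G.run alg T).toOuterMeasure
      {h | G.regret alg x h ≤ 10 * (Fintype.card A * E +
          Fintype.card (Class n S) * Fintype.card A * √(T * logTerm n S A T δ)) ∧
        G.violation Φ hΦ alg h ≤
          10 * (T * Fintype.card (Class n S) * √(logTerm n S A T δ / E))} := by
  obtain ⟨θ₀⟩ : Nonempty Θ := G.prior.support_nonempty.nonempty
  obtain ⟨s₀⟩ : Nonempty S := (G.signal θ₀).support_nonempty.nonempty
  have hC : Nonempty (Class n S) := ⟨classOf fun _ => s₀⟩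
  have hA : Nonempty A := by
    by_contra hA
    rw [not_nonempty_iff] at hA
    simpa using hx.1.1.2 fun _ => s₀
  have hL : 0 < logTerm n S A T δ := zero_lt_one.trans_le (one_le_logTerm hT hδ)
  set L := logTerm n S A T δ with hLdef
  let B : Bool × Class n S × A × Fin T × Bool → Set (Fin T → Round n Θ S A) := fun i =>
    exceed L (G.estimateExponent (if i.1 then G.uR else G.uS) i.2.1 i.2.2.1 i.2.2.2.1
      (if i.2.2.2.2 then 4 * √(L / (2 * (i.2.2.2.1 : ℕ))) else
        -(4 * √(L / (2 * (i.2.2.2.1 : ℕ)))))) T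
  let B₀ : Set (Fin T → Round n Θ S A) := exceed L (G.sampleExponent alg T δ
      (4 * √(T * L / 2) / (T * Fintype.card (Class n S)))) T
  refine le_toOuterMeasure_of_compl _ _ hδ.1.le ?_
  -- Only bad trajectories in the support need to be covered; this brings in the support property of
  -- the sampled mechanisms.
  refine ((G.run alg T).toOuterMeasure_mono (t := B₀ ∪ ⋃ i, B i) ?_).trans ?_
  · rintro h ⟨hbad, hsupp⟩
    by_contra hgood
    rw [Set.mem_union, not_or, Set.mem_iUnion, not_exists] at hgood
    refine hbad ?_
    -- The values beyond T are arbitrary fillers; `h ⟨0, hT⟩` merely supplies an element.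
    obtain ⟨g, rfl⟩ : ∃ g : ℕ → Round n Θ S A, h = fun i : Fin T => g i :=
      ⟨fun k => if hk : k < T then h ⟨k, hk⟩ else h ⟨0, hT⟩, funext fun i => by simp⟩
    refine halg.regret_violation_le hE hL.le hΦ
      (fun t ht c => G.played_ne_zero_of_mem_support alg T _ hsupp ⟨t, ht⟩ c)
      (G.accurate_of_notMem_exceed G.uR T δ hL g fun c a m hm b => ?_)
      (G.accurate_of_notMem_exceed G.uS T δ hL g fun c a m hm b => ?_)
      (G.sample_le_of_notMem_exceed alg hT δ hL g hgood.1) hx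
    · exact hgood.2 (true, c, a, ⟨m, Finset.mem_range.1 hm⟩, b)
    · exact hgood.2 (false, c, a, ⟨m, Finset.mem_range.1 hm⟩, b)
  · have hB : ∀ i, (G.run alg T).toOuterMeasure (B i) ≤ ENNReal.ofReal (Real.exp (-L)) := by
      rintro ⟨b, c, a, m, b'⟩
      refine G.measure_exceed_estimate alg _ ?_ c a m _ L T
      cases b
      exacts [G.uS_mem, G.uR_mem]
    calc _ ≤ (G.run alg T).toOuterMeasure B₀ + ∑ i, (G.run alg T).toOuterMeasure (B i) :=
          (MeasureTheory.measure_union_le _ _).trans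
            (add_le_add_right (MeasureTheory.measure_iUnion_fintype_le _ _) _)
      _ ≤ ENNReal.ofReal (Real.exp (-L)) +
          ∑ _i : Bool × Class n S × A × Fin T × Bool, ENNReal.ofReal (Real.exp (-L)) :=
          add_le_add (G.measure_exceed_sample alg δ _ L T) (Finset.sum_le_sum fun i _ => hB i)
      _ = ENNReal.ofReal (Real.exp (-L) +
          4 * (T * Fintype.card (Class n S) * Fintype.card A) * Real.exp (-L)) := by
          rw [← ENNReal.ofReal_sum_of_nonneg fun _ _ => (Real.exp_pos _).le,
            ← ENNReal.ofReal_add (Real.exp_pos _).le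
              (Finset.sum_nonneg fun _ _ => (Real.exp_pos _).le)]
          congr 2
          simp only [Finset.sum_const, Finset.card_univ, Fintype.card_prod, Fintype.card_bool,
            Fintype.card_fin, nsmul_eq_mul]
          push_cast
          ring
      _ ≤ _ := by
          refine ENNReal.ofReal_le_ofReal ?_
          have h1 : (1 : ℝ) ≤ T := by exact_mod_cast hT
          have h2 : (1 : ℝ) ≤ Fintype.card (Class n S) := by exact_mod_cast Fintype.card_pos
          have h3 : (1 : ℝ) ≤ Fintype.card A := by exact_mod_cast Fintype.card_pos
          have h4 := one_le_mul_of_one_le_of_one_le (one_le_mul_of_one_le_of_one_le h1 h2) h3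
          have hδ0 := hδ.1
          have e : Real.exp (-L) = δ / (8 * (T * Fintype.card (Class n S) * Fintype.card A)) := by
            rw [hLdef, logTerm, Real.exp_neg, Real.exp_log (by positivity), inv_div]
            congr 1
            ring
          rw [e]
          generalize (T * Fintype.card (Class n S) * Fintype.card A : ℝ) = M at *
          -- With M = T|𝒞||𝒜| ≥ 1, the 1 + 4M events have total probability at most (1 + 4M)δ/(8M) ≤
          -- δ.
          rw [← one_add_mul, mul_div_assoc', div_le_iff₀ (by linarith)]
          nlinarith

end HighProbability
end InfoAcq

/-! ### The final bounds and the choice E = ⌊T^α⌋ -/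

theorem mainTheorem3 :
    ∃ K : ℝ, 0 < K ∧
      ∀ (n : ℕ) [NeZero n] (Θ S A : Type*) [Fintype Θ] [Fintype S] [Fintype A]
        (G : InfoAcq.Game Θ S A) (Φ : Finset (S → S)) (hΦ : Φ.Nonempty)
        (xOpt : (Fin n → S) × A → ℝ) (_ : G.IsOptimalIC Φ xOpt)
        (T : ℕ) (δ : ℝ) (_ : δ ∈ Set.Ioo (0 : ℝ) 1),
        (∀ (E : ℕ) (_ : 1 ≤ E) (_ : E ≤ T) (alg : InfoAcq.Algorithm n S A)
            (_ : InfoAcq.IsExploreThenUCB Φ T E δ alg),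
          ENNReal.ofReal (1 - δ) ≤ (G.run alg T).toOuterMeasure
            {h | G.regret alg xOpt h ≤
                  K * (Fintype.card A * E + Fintype.card (InfoAcq.Class n S) * Fintype.card A *
                    √(T * Real.log (8 * T * Fintype.card (InfoAcq.Class n S) *
                      Fintype.card A / δ))) ∧
                G.violation Φ hΦ alg h ≤
                  K * (T * Fintype.card (InfoAcq.Class n S) *
                    √(Real.log (8 * T * Fintype.card (InfoAcq.Class n S) *
                      Fintype.card A / δ) / E))}) ∧
        (∀ (α : ℝ) (_ : α ∈ Set.Icc (1 / 2 : ℝ) 1) (_ : 1 ≤ T) (alg : InfoAcq.Algorithm n S A)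
            (_ : InfoAcq.IsExploreThenUCB Φ T ⌊(T : ℝ) ^ α⌋₊ δ alg),
          ENNReal.ofReal (1 - δ) ≤ (G.run alg T).toOuterMeasure
            {h | G.regret alg xOpt h ≤
                  K * (Fintype.card (InfoAcq.Class n S) * Fintype.card A *
                    √(Real.log (8 * T * Fintype.card (InfoAcq.Class n S) *
                      Fintype.card A / δ)) * (T : ℝ) ^ α) ∧
                G.violation Φ hΦ alg h ≤
                  K * (Fintype.card (InfoAcq.Class n S) *
                    √(Real.log (8 * T * Fintype.card (InfoAcq.Class n S) *
                      Fintype.card A / δ)) * (T : ℝ) ^ (1 - α / 2))}) := by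
  -- Part 1 needs 10; part 2 needs 20, since two terms of the same size are added in the regret and
  -- the floor costs a factor 2 in the violation.
  refine ⟨30, by norm_num, ?_⟩
  intro n _ Θ S A _ _ _ G Φ hΦ xOpt hx T δ hδ
  have hmono : ∀ {alg : InfoAcq.Algorithm n S A}
      {s t : Set (Fin T → InfoAcq.Round n Θ S A)}, s ⊆ t →
      ENNReal.ofReal (1 - δ) ≤ (G.run alg T).toOuterMeasure s →
      ENNReal.ofReal (1 - δ) ≤ (G.run alg T).toOuterMeasure t := fun hst h =>
    h.trans (MeasureTheory.measure_mono hst)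
  refine ⟨fun E hE hET alg halg => ?_, fun α hα hT alg halg => ?_⟩
  · refine hmono ?_ (G.run_regret_violation hΦ hx hE (hE.trans hET) hδ halg)
    rintro h ⟨h1, h2⟩
    unfold InfoAcq.logTerm at h1 h2
    refine ⟨h1.trans ?_, h2.trans ?_⟩ <;>
    exact mul_le_mul_of_nonneg_right (by norm_num) (by positivity)
  · have hT1 : (1 : ℝ) ≤ T := by exact_mod_cast hT
    have hTα : 1 ≤ (T : ℝ) ^ α := Real.one_le_rpow hT1 (by linarith [hα.1])
    have hE : 1 ≤ ⌊(T : ℝ) ^ α⌋₊ := (Nat.one_le_floor_iff _).2 hTα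
    refine hmono ?_ (G.run_regret_violation hΦ hx hE hT hδ halg)
    rintro h ⟨h1, h2⟩
    obtain ⟨θ₀⟩ : Nonempty Θ := G.prior.support_nonempty.nonempty
    obtain ⟨s₀⟩ : Nonempty S := (G.signal θ₀).support_nonempty.nonempty
    have hC : Nonempty (InfoAcq.Class n S) := ⟨InfoAcq.classOf fun _ => s₀⟩
    have hA : Nonempty A := by
      by_contra hA
      rw [not_nonempty_iff] at hA
      simpa using hx.1.1.2 fun _ => s₀
    have hL := InfoAcq.one_le_logTerm (n := n) (S := S) (A := A) hT hδ
    change _ ≤ _ * (_ * √(InfoAcq.logTerm n S A T δ) * _) ∧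
      _ ≤ _ * (_ * √(InfoAcq.logTerm n S A T δ) * _)
    generalize InfoAcq.logTerm n S A T δ = L at *
    have hC1 : (1 : ℝ) ≤ Fintype.card (InfoAcq.Class n S) := by
      exact_mod_cast Fintype.card_pos
    have hA0 : (0 : ℝ) ≤ Fintype.card A := Nat.cast_nonneg _
    have hsL : 1 ≤ √L := Real.one_le_sqrt.2 hL
    generalize (Fintype.card (InfoAcq.Class n S) : ℝ) = C at *
    generalize (Fintype.card A : ℝ) = a at *
    have hEle : (⌊(T : ℝ) ^ α⌋₊ : ℝ) ≤ (T : ℝ) ^ α := Nat.floor_le (by positivity)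
    have hElt : (T : ℝ) ^ α < ⌊(T : ℝ) ^ α⌋₊ + 1 := Nat.lt_floor_add_one _
    have hE1 : (1 : ℝ) ≤ ⌊(T : ℝ) ^ α⌋₊ := by exact_mod_cast hE
    generalize (⌊(T : ℝ) ^ α⌋₊ : ℝ) = e at *
    constructor
    · refine h1.trans ?_
      -- Here α ≥ 1/2 absorbs √T into T^α.
      have h3 : √((T : ℝ) * L) ≤ √L * (T : ℝ) ^ α := by
        rw [mul_comm, Real.sqrt_mul (by linarith), Real.sqrt_eq_rpow (T : ℝ)]
        gcongr
        exact hα.1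
      have h4 : a * e ≤ C * a * √L * (T : ℝ) ^ α := by
        have : a * 1 ≤ a * (C * √L) :=
          mul_le_mul_of_nonneg_left (one_le_mul_of_one_le_of_one_le hC1 hsL) hA0
        calc a * e ≤ (a * (C * √L)) * (T : ℝ) ^ α := by gcongr; linarith
          _ = _ := by ring
      have h5 : C * a * √((T : ℝ) * L) ≤ C * a * (√L * (T : ℝ) ^ α) := by gcongr
      have h6 : 0 ≤ C * a * √L * (T : ℝ) ^ α := by positivity
      linarith
    · refine h2.trans ?_
      -- Since e ≥ 1, the floor loses at most half: T^α < e + 1 ≤ 2e.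
      have h3 : √(L / e) ≤ 2 * (√L * (T : ℝ) ^ (-(α / 2))) := by
        have hp : ((T : ℝ) ^ (-(α / 2))) ^ 2 = ((T : ℝ) ^ α)⁻¹ := by
          rw [← Real.rpow_natCast, ← Real.rpow_mul (by linarith), ← Real.rpow_neg (by linarith)]
          congr 1
          push_cast
          ring
        refine Real.sqrt_le_iff.2 ⟨by positivity, ?_⟩
        rw [mul_pow, mul_pow, hp, Real.sq_sqrt (by linarith), ← div_eq_mul_inv, mul_div_assoc',
          div_le_div_iff₀ (by linarith) (by linarith)]
        nlinarith
      have h4 : (T : ℝ) * (T : ℝ) ^ (-(α / 2)) = (T : ℝ) ^ (1 - α / 2) := by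
        rw [sub_eq_add_neg, Real.rpow_add (by linarith), Real.rpow_one]
      have h5 : (T : ℝ) * C * √(L / e) ≤ T * C * (2 * (√L * (T : ℝ) ^ (-(α / 2)))) := by gcongr
      have h6 : (T : ℝ) * C * (2 * (√L * (T : ℝ) ^ (-(α / 2)))) =
          2 * (C * √L * (T : ℝ) ^ (1 - α / 2)) := by rw [← h4]; ring
      have h7 : 0 ≤ C * √L * (T : ℝ) ^ (1 - α / 2) := by positivity
      linarith
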